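/- Let $f,g:\mathbb R\to\mathbb R$ be admissible: there is $d>0$ such that $f$ and $g$ extend to analytic functions (also denoted $f,g$) on the strip $S_d=\{z\in\mathbb C:|\operatorname{Im}z|<d\}$, and there are positive constants $M_1,M_2,M_3,M_4$ with $$|f'(z)|\le M_1,\qquad M_2\le |g(z)|\le M_3,\qquad \operatorname{Re} g(z)\ne 0,\qquad |g'(z)|\le M_4\qquad (z\in S_d).$$ Fix $C\in\mathbb R$ and $T>0$. For $h>0$ let $x_0=C$, $x_{n+1}=x_n+f(x_n)h+g(x_n)\sqrt h\,Z_{n+1}$ with i.i.d. standard Gaussian $Z_1,Z_2,\dots$, let $t_n=nh$, and let $\tilde p(\cdot,t_n)$ be the probability density of $x_n$ for $n\ge 1$. Put $$G(x,y)=\frac{1}{\sqrt{2\pi g(y)^2h}}\exp\Bigl(-\frac{(x-y-f(y)h)^2}{2g(y)^2h}\Bigr),$$ and for $k>0$ define $\hat p(x,t_1)=G(x,C)$ and $\hat p(x,t_{n+1})=k\sum_{j\in\mathbb Z}G(x,jk)\,\hat p(jk,t_n)$ for $n\ge1$. Let $E=\tilde p-\hat p$. Let $r_1,r_2>0$ and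 $\rho>1/2$ be constants that do not depend on $h$. Then there are a constant $c_\star>0$ that does not depend on $h$ and terms $o(h)$ (a function of $h$) and $o(k)$ (a function of $k$), as $h\to0^+$ and $k\to0^+$ respectively, such that the following holds. Let $k=r_1h^{\rho}$ and $a=r_2h^{1/2}$, where $$0<h<\min\Bigl\{T,\Bigl(\frac{M_2^2}{4M_3M_4r_2}\Bigr)^2\Bigr\},\qquad N=T/h\in\mathbb N^+,\qquad a<\min\Bigl\{d,\frac{M_2^2}{2M_3M_4}\Bigr\},$$ $$k\le 2\pi(\log 2)^{-1/2}M_2h^{1/2},\qquad k<\frac{2\pi a}{\log 2}.$$ Then $\tilde p(\cdot,T)$ exists, the series defining $\hat p(\cdot,t_n)$ converge for $n\le N$, $E(\cdot,T)$ is integrable, and $$\int_{\mathbb R}|E(x,T)|\,dx\le c_\star h^{-1}\exp\bigl(-2\pi r_2r_1^{-1}h^{1/2-\rho}\bigr)\bigl(1+o(h)+o(k)\bigr).$$ -/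

import Mathlib

open MeasureTheory ProbabilityTheory Filter Topology Asymptotics

namespace DTQ

noncomputable section

/-- The open horizontal strip `S_a = {z : |Im z| < a}` in the complex plane. -/
def strip (a : ℝ) : Set ℂ := {z : ℂ | |z.im| < a}

/-- The real coefficients `f` and `g` are admissible with half-width `d` and constants
`M₁, M₂, M₃, M₄`: they are restrictions to the real line of functions `F` and `K` that are analytic
on the strip `S_d` and satisfy the stated bounds there. -/
def Admissible (f g : ℝ → ℝ) (d M₁ M₂ M₃ M₄ : ℝ) : Prop :=
  0 < d ∧ 0 < M₁ ∧ 0 < M₂ ∧ 0 < M₃ ∧ 0 < M₄ ∧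
    ∃ F K : ℂ → ℂ,
      (∀ x : ℝ, F (x : ℂ) = (f x : ℂ)) ∧
      (∀ x : ℝ, K (x : ℂ) = (g x : ℂ)) ∧
      AnalyticOnNhd ℂ F (strip d) ∧
      AnalyticOnNhd ℂ K (strip d) ∧
      ∀ z ∈ strip d,
        ‖deriv F z‖ ≤ M₁ ∧
        (M₂ ≤ ‖K z‖ ∧ ‖K z‖ ≤ M₃) ∧
        (K z).re ≠ 0 ∧
        ‖deriv K z‖ ≤ M₄

/-- The Euler–Maruyama chain started at `C` with time step `h`:
`x₀ = C`, `x_{n+1} = x_n + f(x_n) h + g(x_n) √h Z_{n+1}`. The noise sequence is indexed from `0`,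
so that `Z n` is the increment used in the step from `x_n` to `x_{n+1}`. -/
def emChain {Ω : Type*} (f g : ℝ → ℝ) (C h : ℝ) (Z : ℕ → Ω → ℝ) : ℕ → Ω → ℝ
  | 0, _ => C
  | n + 1, ω =>
      emChain f g C h Z n ω + f (emChain f g C h Z n ω) * h +
        g (emChain f g C h Z n ω) * √h * Z n ω

/-- The one-step transition density `G(x, y)`: the Gaussian density in `x` with mean
`y + f(y) h` and variance `g(y)² h`. -/
def G (f g : ℝ → ℝ) (h x y : ℝ) : ℝ :=
  1 / √(2 * Real.pi * g y ^ 2 * h) *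
    Real.exp (-((x - y - f y * h) ^ 2 / (2 * g y ^ 2 * h)))

/-- The DTQ density `p̂(x, t_n)`, `n ≥ 1`, on the infinite grid `{j k : j ∈ ℤ}`:
`p̂(x, t₁) = G(x, C)` and `p̂(x, t_{n+1}) = k ∑_j G(x, j k) p̂(j k, t_n)`.
There is no function `p̂(·, t₀)` (the initial law is a point mass at `C`); the value at `n = 0` is a
placeholder that the recursion never uses. -/
def pHat (f g : ℝ → ℝ) (C h k : ℝ) : ℕ → ℝ → ℝ
  | 0, _ => 0
  | 1, x => G f g h x C
  | n + 2, x => k * ∑' j : ℤ, G f g h x (j * k) * pHat f g C h k (n + 1) (j * k)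

/-- The density `p̃(x, t_n)` of the Euler–Maruyama chain at step `n`, as a real-valued function. -/
def pTilde {Ω : Type*} [MeasurableSpace Ω] (P : Measure Ω) (f g : ℝ → ℝ) (C h : ℝ)
    (Z : ℕ → Ω → ℝ) (n : ℕ) (x : ℝ) : ℝ :=
  (pdf (emChain f g C h Z n) P volume x).toReal

/-- The error `E(x, t_n) = p̃(x, t_n) - p̂(x, t_n)`. -/
def err {Ω : Type*} [MeasurableSpace Ω] (P : Measure Ω) (f g : ℝ → ℝ) (C h k : ℝ)
    (Z : ℕ → Ω → ℝ) (n : ℕ) (x : ℝ) : ℝ :=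
  pTilde P f g C h Z n x - pHat f g C h k n x

end

end DTQ

/-!
The iterates of the exact transition operator `u ↦ ∫ G(·, y) u(y) dy` and of its trapezoidal
discretization start from the same density `G(·, C)`. The exact operator contracts `L¹`
(`QuadratureKernel.integrable_transition`), so the error at time `T` is at most the sum of the
`N - 1` one-step quadrature errors
(`QuadratureKernel.lintegral_chainDensity_sub_gridDensity`).

Each `p̂(·, t_n)` is a countable superposition of transition densities `G(·, s)`
(`QuadratureKernel.isMixture_gridDensity`). By linearity it suffices to bound, for one real `s`, the
error of the trapezoidal rule for `y ↦ G(x, y) G(y, s)`, integrated over `x`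
(`StripExtension.lintegral_two_step_error`), together with the growth of the total weight
`k ∑ⱼ p̂(jk, t_n)`, which is again a trapezoidal error (`StripExtension.grid_mass_G`).

For an integrand holomorphic in the strip `|Im z| ≤ a`, Poisson summation and a contour shift bound
the trapezoidal error by the `L¹` norms on the edges of the strip times `1 / (e^{2πa/k} - 1)`
(`norm_mul_tsum_sub_integral_le`). The diffusion coefficient is real and bounded away
from `0` on `ℝ` and has a bounded derivative, so its square stays in a half-plane `Re > 0` when the strip is thin, and the continued
kernel is still dominated by a Gaussian. The continuation costs a factor `exp (const · a² / h)`,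
which is a constant precisely because `a` is proportional to `√h`
(`StripExtension.exists_lintegral_kernel_le`). With `2πa/k = 2π (r₂/r₁) h^{1/2-ρ} =: u`, every
one-step error is `O(e^{-u})`, the total weight is at most `(1 + O(e^{-u}))^N`, which is bounded
since `N e^{-u} = T h⁻¹ e^{-u}` is, and the sum of `N = T / h` errors is `O(h⁻¹ e^{-u})`.
-/

/-! ### The trapezoidal rule in a strip -/

namespace DTQ

/-- A function dominated by `A / (1 + x²)` is integrable. -/
theorem integrable_of_norm_le_div_one_add_sq {E : Type*} [NormedAddCommGroup E] {φ : ℝ → E} {A : ℝ}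
    (hc : Continuous φ) (hb : ∀ x, ‖φ x‖ ≤ A / (1 + x ^ 2)) : Integrable φ := by
  refine (integrable_inv_one_add_sq.const_mul A).mono' hc.aestronglyMeasurable ?_
  exact Eventually.of_forall fun x => by simpa [div_eq_mul_inv] using hb x

/-- The integer samples of a function dominated by `A / (1 + x²)` are summable. -/
theorem summable_of_norm_le_div_one_add_sq {E : Type*} [NormedAddCommGroup E] [CompleteSpace E]
    {u : ℤ → E} {A : ℝ} (hA : 0 ≤ A) (hb : ∀ n : ℤ, ‖u n‖ ≤ A / (1 + (n : ℝ) ^ 2)) :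
    Summable u := by
  have h2 : Summable fun n : ℤ => |(n : ℝ)| ^ (-(2 : ℝ)) :=
    Real.summable_abs_int_rpow one_lt_two
  refine Summable.of_norm_bounded_eventually (h2.mul_left A) ?_
  have : ∀ᶠ n : ℤ in cofinite, n ≠ 0 := by
    rw [eventually_cofinite]
    exact (Set.finite_singleton (0 : ℤ)).subset fun n hn => by simpa using hn
  filter_upwards [this] with n hn
  have h0 : (0 : ℝ) < |(n : ℝ)| := by positivity
  refine (hb n).trans ?_
  rw [Real.rpow_neg h0.le, Real.rpow_two, sq_abs, div_eq_mul_inv]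
  have : (0 : ℝ) < (n : ℝ) ^ 2 := by positivity
  gcongr
  linarith

/-- Contour shift: the integral of a function holomorphic in a closed strip and decaying like
`1 / x²` does not change when the line of integration moves from `ℝ` to `ℝ + ib`. -/
theorem integral_eq_integral_add_mul_I {φ : ℂ → ℂ} {A b : ℝ}
    (hd : ∀ z : ℂ, |z.im| ≤ |b| → DifferentiableAt ℂ φ z)
    (hb : ∀ z : ℂ, |z.im| ≤ |b| → ‖φ z‖ ≤ A / (1 + z.re ^ 2)) :
    ∫ x : ℝ, φ x = ∫ x : ℝ, φ (x + b * Complex.I) := by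
  have hline : ∀ c : ℝ, |c| ≤ |b| → Integrable fun x : ℝ => φ (x + c * Complex.I) := by
    intro c hc
    refine integrable_of_norm_le_div_one_add_sq (A := A) ?_ fun x => ?_
    · refine continuous_iff_continuousAt.2 fun x => ?_
      refine ContinuousAt.comp (f := fun x : ℝ => (x + c * Complex.I : ℂ)) (g := φ) ?_
        (by fun_prop)
      exact (hd _ (by simpa using hc)).continuousAt
    · simpa using hb (x + c * Complex.I) (by simpa using hc)
  have h0 := intervalIntegral_tendsto_integral (hline 0 (by simp)) tendsto_neg_atTop_atBot
    tendsto_id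
  have h1 := intervalIntegral_tendsto_integral (hline b le_rfl) tendsto_neg_atTop_atBot tendsto_id
  have hvert : ∀ s : ℝ → ℝ, (∀ R, s R ^ 2 = R ^ 2) →
      Tendsto (fun R : ℝ => ∫ y : ℝ in (0 : ℝ)..b, φ (s R + y * Complex.I)) atTop (𝓝 0) := by
    intro s hs
    have hlim : Tendsto (fun R : ℝ => A / (1 + R ^ 2) * |b - 0|) atTop (𝓝 0) := by
      have : Tendsto (fun R : ℝ => 1 + R ^ 2) atTop atTop :=
        tendsto_atTop_add_const_left _ _ (tendsto_pow_atTop two_ne_zero)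
      simpa using (this.const_div_atTop A).mul_const |b - 0|
    refine squeeze_zero_norm (fun R => ?_) hlim
    refine intervalIntegral.norm_integral_le_of_norm_le_const fun y hy => ?_
    have hy' : |y| ≤ |b| := by
      rcases Set.mem_uIoc.1 hy with ⟨h1, h2⟩ | ⟨h1, h2⟩
      · rw [abs_of_pos h1, abs_of_pos (h1.trans_le h2)]; exact h2
      · rw [abs_of_nonpos h2, abs_of_neg (h1.trans_le h2)]; linarith
    simpa [hs R] using hb (s R + y * Complex.I) (by simpa using hy')
  have hrect : ∀ R : ℝ, (∫ x : ℝ in -R..R, φ (x + (0 : ℝ) * Complex.I)) =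
      (∫ x : ℝ in -R..R, φ (x + b * Complex.I))
        - Complex.I * (∫ y : ℝ in (0 : ℝ)..b, φ (R + y * Complex.I))
        + Complex.I * ∫ y : ℝ in (0 : ℝ)..b, φ ((-R : ℝ) + y * Complex.I) := by
    intro R
    have := Complex.integral_boundary_rect_eq_zero_of_differentiableOn φ (((-R : ℝ) : ℂ))
      (R + b * Complex.I) (fun z hz => by
        have hz2 := hz.2
        simp only [Set.mem_preimage, Complex.ofReal_im, Complex.add_im, Complex.mul_im,
          Complex.ofReal_re, Complex.I_im, Complex.I_re, mul_one, mul_zero, add_zero, zero_add]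
          at hz2
        refine (hd z ?_).differentiableWithinAt
        rcases Set.mem_uIcc.1 hz2 with ⟨h1, h2⟩ | ⟨h1, h2⟩
        · rw [abs_of_nonneg h1, abs_of_nonneg (h1.trans h2)]; exact h2
        · rw [abs_of_nonpos h2, abs_of_nonpos (h1.trans h2)]; linarith)
    simp only [Complex.ofReal_im, Complex.add_im, Complex.mul_im, Complex.add_re, Complex.mul_re,
      Complex.ofReal_re, Complex.I_im, Complex.I_re, mul_one, mul_zero, add_zero, zero_add,
      sub_zero, smul_eq_mul] at this
    linear_combination this
  have h2 : Tendsto (fun R : ℝ => ∫ x : ℝ in -R..R, φ (x + (0 : ℝ) * Complex.I)) atTop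
      (𝓝 (∫ x : ℝ, φ (x + b * Complex.I))) := by
    simp_rw [hrect]
    have hR := (hvert (fun R => R) (fun _ => rfl)).const_mul Complex.I
    have hL := (hvert (fun R => -R) (fun _ => by ring)).const_mul Complex.I
    simpa using (h1.sub hR).add hL
  simpa using tendsto_nhds_unique h0 h2

open FourierTransform in
/-- The Fourier transform of a function holomorphic in the strip `|Im z| ≤ a` decays like
`exp (-2π a |w|)`: shift the contour to the edge where the exponential is small. -/
theorem norm_fourier_le_of_strip {φ : ℂ → ℂ} {a A : ℝ}
    (hd : ∀ z : ℂ, |z.im| ≤ |a| → DifferentiableAt ℂ φ z)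
    (hb : ∀ z : ℂ, |z.im| ≤ |a| → ‖φ z‖ ≤ A / (1 + z.re ^ 2)) (w : ℝ) :
    ‖𝓕 (fun x : ℝ => φ x) w‖ ≤
      Real.exp (2 * Real.pi * a * w) * ∫ x : ℝ, ‖φ (x + a * Complex.I)‖ := by
  have hA : 0 ≤ A := by simpa using (norm_nonneg _).trans (hb 0 (by simp))
  set e : ℂ → ℂ := fun z => Complex.exp (-2 * Real.pi * w * Complex.I * z) with he
  have hne : ∀ z : ℂ, ‖e z‖ = Real.exp (2 * Real.pi * w * z.im) := by
    intro z
    rw [he, Complex.norm_exp]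
    congr 1
    simp [Complex.mul_re, Complex.mul_im]
  have hshift := integral_eq_integral_add_mul_I (φ := fun z => e z * φ z) (b := a)
    (A := Real.exp (|2 * Real.pi * w| * |a|) * A)
    (fun z hz => by
      have := hd z hz
      fun_prop) (fun z hz => by
      rw [norm_mul, hne, mul_div_assoc]
      refine mul_le_mul (Real.exp_le_exp.2 ?_) (hb z hz) (norm_nonneg _) (Real.exp_nonneg _)
      refine (le_abs_self _).trans ?_
      rw [abs_mul]
      gcongr)
  have h1 : 𝓕 (fun x : ℝ => φ x) w = ∫ x : ℝ, e x * φ x := by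
    rw [Real.fourier_real_eq_integral_exp_smul]
    refine integral_congr_ae (Eventually.of_forall fun x => ?_)
    simp only [smul_eq_mul, he]
    congr 2
    push_cast
    ring
  rw [h1, hshift, ← integral_const_mul]
  refine (norm_integral_le_integral_norm _).trans (le_of_eq ?_)
  refine integral_congr_ae (Eventually.of_forall fun x => ?_)
  simp only [norm_mul, hne]
  congr 2
  simp
  ring

theorem norm_tsum_sub_zero_le {u : ℤ → ℂ} {t P Q : ℝ} (ht : 0 < t)
    (hpos : ∀ n : ℕ, ‖u (n + 1)‖ ≤ Real.exp (-(t * (n + 1))) * P)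
    (hneg : ∀ n : ℕ, ‖u (-(n + 1))‖ ≤ Real.exp (-(t * (n + 1))) * Q) :
    Summable u ∧ ‖∑' n, u n - u 0‖ ≤ (P + Q) / (Real.exp t - 1) := by
  have hlt : Real.exp (-t) < 1 := by simpa using ht
  have hgeo : HasSum (fun n : ℕ => Real.exp (-(t * (n + 1)))) (1 / (Real.exp t - 1)) := by
    have h := (hasSum_geometric_of_lt_one (Real.exp_nonneg (-t)) hlt).mul_left (Real.exp (-t))
    have h1 : Real.exp t - 1 ≠ 0 := by
      have := Real.add_one_lt_exp ht.ne'
      linarith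
    have e1 : (1 : ℝ) / (Real.exp t - 1) = Real.exp (-t) * (1 - Real.exp (-t))⁻¹ := by
      rw [Real.exp_neg]
      field_simp
    have e2 : (fun n : ℕ => Real.exp (-(t * (n + 1)))) =
        fun n : ℕ => Real.exp (-t) * Real.exp (-t) ^ n := by
      ext n
      rw [← Real.exp_nat_mul, ← Real.exp_add]
      ring_nf
    rw [e1, e2]
    exact h
  have sP : Summable fun n : ℕ => u (n + 1) :=
    Summable.of_norm_bounded (hgeo.summable.mul_right P) hpos
  have sN : Summable fun n : ℕ => u (-(n + 1)) :=
    Summable.of_norm_bounded (hgeo.summable.mul_right Q) hneg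
  have hsum := HasSum.of_add_one_of_neg_add_one sP.hasSum sN.hasSum
  refine ⟨hsum.summable, ?_⟩
  rw [hsum.tsum_eq]
  have bP := tsum_of_norm_bounded (hgeo.mul_right P) hpos
  have bN := tsum_of_norm_bounded (hgeo.mul_right Q) hneg
  calc ‖∑' n : ℕ, u (n + 1) + u 0 + ∑' n : ℕ, u (-(n + 1)) - u 0‖
      = ‖∑' n : ℕ, u (n + 1) + ∑' n : ℕ, u (-(n + 1))‖ := by congr 1; ring
    _ ≤ _ := norm_add_le_of_le bP bN
    _ = _ := by ring

open FourierTransform in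
/-- Exponential accuracy of the trapezoidal rule with unit step, from Poisson summation. -/
theorem norm_tsum_sub_integral_le {φ : ℂ → ℂ} {a A : ℝ} (ha : 0 < a)
    (hd : ∀ z : ℂ, |z.im| ≤ a → DifferentiableAt ℂ φ z)
    (hb : ∀ z : ℂ, |z.im| ≤ a → ‖φ z‖ ≤ A / (1 + z.re ^ 2)) :
    ‖∑' n : ℤ, φ n - ∫ x : ℝ, φ x‖ ≤
      ((∫ x : ℝ, ‖φ (x + a * Complex.I)‖) + ∫ x : ℝ, ‖φ (x - a * Complex.I)‖) /
        (Real.exp (2 * Real.pi * a) - 1) := by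
  have hA : 0 ≤ A := by simpa using (norm_nonneg _).trans (hb 0 (by simpa using ha.le))
  have hpos : ∀ w : ℝ, ‖𝓕 (fun x : ℝ => φ x) w‖ ≤
      Real.exp (2 * Real.pi * a * w) * ∫ x : ℝ, ‖φ (x + a * Complex.I)‖ :=
    norm_fourier_le_of_strip (A := A) (by simpa [abs_of_pos ha] using hd)
      (by simpa [abs_of_pos ha] using hb)
  have hneg : ∀ w : ℝ, ‖𝓕 (fun x : ℝ => φ x) w‖ ≤
      Real.exp (2 * Real.pi * (-a) * w) * ∫ x : ℝ, ‖φ (x - a * Complex.I)‖ := by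
    simpa [sub_eq_add_neg] using norm_fourier_le_of_strip (a := -a) (A := A)
      (by simpa [abs_of_pos ha] using hd) (by simpa [abs_of_pos ha] using hb)
  obtain ⟨hs, hle⟩ := norm_tsum_sub_zero_le (u := fun n : ℤ => 𝓕 (fun x : ℝ => φ x) n)
    (t := 2 * Real.pi * a) (P := ∫ x : ℝ, ‖φ (x - a * Complex.I)‖)
    (Q := ∫ x : ℝ, ‖φ (x + a * Complex.I)‖) (by positivity)
    (fun n => by
      convert hneg ((n : ℤ) + 1 : ℤ) using 3
      push_cast; ring)
    (fun n => by
      convert hpos (-((n : ℤ) + 1) : ℤ) using 3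
      push_cast; ring)
  have hcont : Continuous fun x : ℝ => φ x := by
    refine continuous_iff_continuousAt.2 fun x => ?_
    exact ContinuousAt.comp (f := fun x : ℝ => (x : ℂ)) (g := φ)
      (hd _ (by simpa using ha.le)).continuousAt (by fun_prop)
  have hO : (fun x : ℝ => φ x) =O[cocompact ℝ] fun x : ℝ => |x| ^ (-(2 : ℝ)) := by
    refine IsBigO.of_bound A ?_
    have : ∀ᶠ x : ℝ in cocompact ℝ, x ≠ 0 := by
      simpa using (isCompact_singleton (x := (0 : ℝ))).compl_mem_cocompact
    filter_upwards [this] with x hx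
    have h0 : 0 < |x| := abs_pos.2 hx
    rw [Real.norm_of_nonneg (by positivity), Real.rpow_neg h0.le, Real.rpow_two, sq_abs]
    refine (hb x (by simpa using ha.le)).trans ?_
    have : 0 < x ^ 2 := by positivity
    rw [Complex.ofReal_re, div_eq_mul_inv]
    gcongr
    linarith
  have hP := Real.tsum_eq_tsum_fourier_of_rpow_decay_of_summable hcont one_lt_two hO hs 0
  have h0 : 𝓕 (fun x : ℝ => φ x) ((0 : ℤ) : ℝ) = ∫ x : ℝ, φ x := by
    rw [Real.fourier_real_eq_integral_exp_smul]
    simp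
  simp only [zero_add, QuotientAddGroup.mk_zero, fourier_eval_zero, mul_one] at hP
  rw [← h0]
  push_cast at hP
  rw [hP, add_comm (∫ x : ℝ, ‖φ (x + a * Complex.I)‖)]
  exact hle

/-- The trapezoidal rule with step `k` for a function holomorphic in the strip `|Im z| ≤ a`:
the error is bounded by the `L¹` norms on the edges of the strip, times `1 / (e^{2πa/k} - 1)`. -/
theorem norm_mul_tsum_sub_integral_le {φ : ℂ → ℂ} {a A k : ℝ} (ha : 0 < a) (hk : 0 < k)
    (hd : ∀ z : ℂ, |z.im| ≤ a → DifferentiableAt ℂ φ z)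
    (hb : ∀ z : ℂ, |z.im| ≤ a → ‖φ z‖ ≤ A / (1 + z.re ^ 2)) :
    ‖k * ∑' n : ℤ, φ (n * k) - ∫ x : ℝ, φ x‖ ≤
      ((∫ x : ℝ, ‖φ (x + a * Complex.I)‖) + ∫ x : ℝ, ‖φ (x - a * Complex.I)‖) /
        (Real.exp (2 * Real.pi * a / k) - 1) := by
  have hA : 0 ≤ A := by simpa using (norm_nonneg _).trans (hb 0 (by simpa using ha.le))
  have him : ∀ z : ℂ, |z.im| ≤ a / k → |(z * k).im| ≤ a := by
    intro z hz
    rw [Complex.im_mul_ofReal, abs_mul, abs_of_pos hk]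
    exact (le_div_iff₀ hk).1 hz
  have hdec : ∀ z : ℂ, |z.im| ≤ a / k →
      ‖φ (z * k)‖ ≤ (A * max 1 (k ^ 2)⁻¹) / (1 + z.re ^ 2) := by
    intro z hz
    refine (hb _ (him z hz)).trans ?_
    rw [Complex.re_mul_ofReal, mul_div_assoc, div_eq_mul_inv]
    gcongr
    rw [inv_eq_one_div, div_le_div_iff₀ (by positivity) (by positivity)]
    have h1 : 1 ≤ max 1 (k ^ 2)⁻¹ := le_max_left _ _
    have h2 : 1 ≤ max 1 (k ^ 2)⁻¹ * k ^ 2 := by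
      calc (1 : ℝ) = (k ^ 2)⁻¹ * k ^ 2 := by field_simp
        _ ≤ _ := by gcongr; exact le_max_right _ _
    nlinarith [sq_nonneg z.re]
  have main := norm_tsum_sub_integral_le (φ := fun z => φ (z * k)) (a := a / k)
    (A := A * max 1 (k ^ 2)⁻¹) (by positivity)
    (fun z hz => by
      have := hd _ (him z hz)
      exact this.comp z (by fun_prop)) hdec
  have hk' : (k : ℂ) ≠ 0 := by exact_mod_cast hk.ne'
  have e0 : (∫ x : ℝ, φ (x * k)) = (k⁻¹ : ℝ) • ∫ x : ℝ, φ x := by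
    have := Measure.integral_comp_mul_right (fun x : ℝ => φ x) k
    rw [abs_of_pos (inv_pos.2 hk)] at this
    simpa using this
  have e1 : (∫ x : ℝ, ‖φ ((x + (a / k : ℝ) * Complex.I) * k)‖) =
      k⁻¹ * ∫ x : ℝ, ‖φ (x + a * Complex.I)‖ := by
    have := Measure.integral_comp_mul_right (fun x : ℝ => ‖φ (x + a * Complex.I)‖) k
    rw [abs_of_pos (inv_pos.2 hk), smul_eq_mul] at this
    rw [← this]
    congr 1 with x
    congr 2
    push_cast
    field_simp
  have e2 : (∫ x : ℝ, ‖φ ((x - (a / k : ℝ) * Complex.I) * k)‖) =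
      k⁻¹ * ∫ x : ℝ, ‖φ (x - a * Complex.I)‖ := by
    have := Measure.integral_comp_mul_right (fun x : ℝ => ‖φ (x - a * Complex.I)‖) k
    rw [abs_of_pos (inv_pos.2 hk), smul_eq_mul] at this
    rw [← this]
    congr 1 with x
    congr 2
    push_cast
    field_simp
  rw [e0, e1, e2, ← mul_add] at main
  have h3 : (k : ℂ) * ∑' n : ℤ, φ (n * k) - ∫ x : ℝ, φ x =
      k * (∑' n : ℤ, φ (n * k) - (k⁻¹ : ℝ) • ∫ x : ℝ, φ x) := by
    rw [Complex.real_smul]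
    push_cast
    field_simp
  rw [h3, norm_mul, Complex.norm_real, Real.norm_of_nonneg hk.le]
  calc _ ≤ k * (k⁻¹ * ((∫ x : ℝ, ‖φ (x + a * Complex.I)‖) + ∫ x : ℝ, ‖φ (x - a * Complex.I)‖) /
        (Real.exp (2 * Real.pi * (a / k)) - 1)) := by gcongr
    _ = _ := by
      rw [mul_div_assoc, ← mul_assoc, mul_inv_cancel₀ hk.ne', one_mul, mul_div_assoc (2 * Real.pi)]

end DTQ

/-! ### Holomorphic continuation of the transition density -/

namespace DTQ

/-- The transition density continued to complex arguments, with `F` and `W` in the roles of the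
drift and of the absolute value of the diffusion coefficient. -/
noncomputable def kernel (F W : ℂ → ℂ) (h : ℝ) (x z : ℂ) : ℂ :=
  (√(2 * Real.pi * h) * W z)⁻¹ * Complex.exp (-((x - z - F z * h) ^ 2 / (2 * W z ^ 2 * h)))

theorem differentiable_kernel_left (F W : ℂ → ℂ) (h : ℝ) (y : ℂ) :
    Differentiable ℂ fun z => kernel F W h z y := by
  unfold kernel
  fun_prop

/-- `F` and `W` extend `f` and `|g|` holomorphically to the closed strip `|Im z| ≤ a`, which is so
thin that `W²` stays in a fixed half-plane `Re > 0`. The absolute value is harmless, since the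
transition density depends on `|g|` only, and it removes the sign of `g` from the formulas. -/
structure StripExtension (f g : ℝ → ℝ) (F W : ℂ → ℂ) (a M₁ M₂ M₃ : ℝ) : Prop where
  M₁_pos : 0 < M₁
  M₂_pos : 0 < M₂
  M₃_pos : 0 < M₃
  nonneg : 0 ≤ a
  F_ofReal : ∀ x : ℝ, F x = f x
  W_ofReal : ∀ x : ℝ, W x = (|g x| : ℝ)
  F_diff : ∀ z : ℂ, |z.im| ≤ a → DifferentiableAt ℂ F z
  W_diff : ∀ z : ℂ, |z.im| ≤ a → DifferentiableAt ℂ W z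
  abs_im_F_le : ∀ z : ℂ, |z.im| ≤ a → |(F z).im| ≤ M₁ * a
  le_norm_W : ∀ z : ℂ, |z.im| ≤ a → M₂ ≤ ‖W z‖
  norm_W_le : ∀ z : ℂ, |z.im| ≤ a → ‖W z‖ ≤ M₃
  le_re_W_sq : ∀ z : ℂ, |z.im| ≤ a → M₂ ^ 2 / 2 ≤ (W z ^ 2).re

theorem convex_strip (d : ℝ) : Convex ℝ (strip d) := by
  have : strip d = Complex.imLm ⁻¹' Set.Ioo (-d) d := by
    ext z
    simp [strip, abs_lt]
  rw [this]
  exact (convex_Ioo (-d) d).linear_preimage _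

/-- On the strip, a holomorphic function with bounded derivative is close to its value at the
real part of the argument. -/
theorem norm_sub_ofReal_re_le {H : ℂ → ℂ} {d M : ℝ} (hH : AnalyticOnNhd ℂ H (strip d))
    (hM : ∀ z ∈ strip d, ‖deriv H z‖ ≤ M) {z : ℂ} (hz : z ∈ strip d) :
    ‖H z - H z.re‖ ≤ M * |z.im| := by
  have hre : (z.re : ℂ) ∈ strip d := by
    have : |z.im| < d := hz
    simpa [strip] using (abs_nonneg _).trans_lt this
  have := (convex_strip d).norm_image_sub_le_of_norm_deriv_le
    (fun w hw => (hH w hw).differentiableAt) hM hre hz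
  have e : z - z.re = z.im * Complex.I := by
    apply Complex.ext <;> simp
  simpa [e] using this

theorem Admissible.continuous_g {f g : ℝ → ℝ} {d M₁ M₂ M₃ M₄ : ℝ}
    (hfg : Admissible f g d M₁ M₂ M₃ M₄) : Continuous g := by
  obtain ⟨hd, -, -, -, -, F, K, -, hK, -, aK, -⟩ := hfg
  have : Continuous fun x : ℝ => (K x).re := by
    refine Complex.continuous_re.comp (continuous_iff_continuousAt.2 fun x => ?_)
    exact ContinuousAt.comp (f := fun x : ℝ => (x : ℂ)) (g := K)
      (aK x (by simpa [strip] using hd)).continuousAt (by fun_prop)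
  simpa [hK] using this

/-- The factor `4` in the width gives `|W² - g²| ≤ 2 M₃ M₄ a ≤ M₂² / 2`, so that `Re W²` stays
above `M₂² / 2`. -/
theorem Admissible.exists_stripExtension {f g : ℝ → ℝ} {d M₁ M₂ M₃ M₄ : ℝ}
    (hfg : Admissible f g d M₁ M₂ M₃ M₄) :
    ∃ F W : ℂ → ℂ, ∀ a, 0 ≤ a → a < d → a ≤ M₂ ^ 2 / (4 * M₃ * M₄) →
      StripExtension f g F W a M₁ M₂ M₃ := by
  have hgc := hfg.continuous_g
  obtain ⟨hd, h1, h2, h3, h4, F, K, hF, hK, aF, aK, hb⟩ := hfg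
  have hreal : ∀ x : ℝ, (x : ℂ) ∈ strip d := fun x => by simpa [strip] using hd
  -- `g` has constant sign, since it is continuous and does not vanish
  have hg0 : ∀ x, g x ≠ 0 := fun x h0 => by
    have := (hb x (hreal x)).2.1.1
    rw [hK, h0] at this
    simp at this
    linarith
  obtain ⟨σ, hσ, hσg⟩ : ∃ σ : ℝ, |σ| = 1 ∧ ∀ x, |g x| = σ * g x := by
    by_cases hpos : ∀ x, 0 < g x
    · exact ⟨1, by simp, fun x => by simp [abs_of_pos (hpos x)]⟩
    · push Not at hpos
      obtain ⟨y, hy⟩ := hpos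
      refine ⟨-1, by simp, fun x => ?_⟩
      have : g x ≤ 0 := by
        by_contra! hx
        obtain ⟨u, hu⟩ := intermediate_value_univ y x hgc ⟨hy, hx.le⟩
        exact hg0 u hu
      rw [abs_of_nonpos this]; ring
  have hσ2 : (σ : ℂ) ^ 2 = 1 := by
    rw [← Complex.ofReal_pow, ← sq_abs, hσ]; simp
  have hnσ : ∀ w : ℂ, ‖(σ : ℂ) * w‖ = ‖w‖ := fun w => by
    rw [norm_mul, Complex.norm_real, Real.norm_eq_abs, hσ, one_mul]
  refine ⟨F, fun z => σ * K z, fun a ha had haM => ?_⟩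
  have hz : ∀ z : ℂ, |z.im| ≤ a → z ∈ strip d := fun z h => h.trans_lt had
  refine ⟨h1, h2, h3, ha, hF, fun x => by rw [hK, hσg]; push_cast; rfl,
    fun z h => (aF z (hz z h)).differentiableAt, fun z h =>
      (aK z (hz z h)).differentiableAt.const_mul _, fun z h => ?_, fun z h => ?_, fun z h => ?_,
    fun z h => ?_⟩
  · have e : (F z).im = (F z - F z.re).im := by rw [hF]; simp
    rw [e]
    refine (Complex.abs_im_le_norm _).trans ((norm_sub_ofReal_re_le aF (fun w hw => (hb w hw).1)
      (hz z h)).trans ?_)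
    gcongr
  · rw [hnσ]; exact (hb z (hz z h)).2.1.1
  · rw [hnσ]; exact (hb z (hz z h)).2.1.2
  · rw [mul_pow, hσ2, one_mul]
    have hr := hreal z.re
    have e1 : ‖K z ^ 2 - K z.re ^ 2‖ ≤ M₂ ^ 2 / 2 := by
      have hsub := norm_sub_ofReal_re_le aK (fun w hw => (hb w hw).2.2.2) (hz z h)
      have hadd : ‖K z + K z.re‖ ≤ M₃ + M₃ :=
        norm_add_le_of_le (hb z (hz z h)).2.1.2 (hb _ hr).2.1.2
      calc ‖K z ^ 2 - K z.re ^ 2‖ = ‖K z - K z.re‖ * ‖K z + K z.re‖ := by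
            rw [← norm_mul]; ring_nf
        _ ≤ (M₄ * a) * (M₃ + M₃) := by
            gcongr
            exact hsub.trans (by gcongr)
        _ ≤ M₄ * (M₂ ^ 2 / (4 * M₃ * M₄)) * (M₃ + M₃) := by gcongr
        _ = M₂ ^ 2 / 2 := by field_simp; ring
    have e2 : M₂ ^ 2 ≤ (K z.re ^ 2).re := by
      have hn := (hb _ hr).2.1.1
      rw [hK] at hn ⊢
      rw [Complex.norm_real, Real.norm_eq_abs] at hn
      rw [← Complex.ofReal_pow, Complex.ofReal_re, ← sq_abs (g z.re)]
      gcongr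
    have e3 := (Complex.abs_re_le_norm _).trans e1
    rw [Complex.sub_re, abs_le] at e3
    linarith [e3.1]

/-- The quadratic form `Re (u ζ²)` with `Re u ≥ α > 0` is positive up to a multiple of
`(Im ζ)²`. -/
theorem le_re_sq_mul {u ζ : ℂ} {α B : ℝ} (hα : 0 < α) (hu : α ≤ u.re) (hB : ‖u‖ ≤ B) :
    α / 2 * ζ.re ^ 2 - (B + 2 * B ^ 2 / α) * ζ.im ^ 2 ≤ (ζ ^ 2 * u).re := by
  have hre : u.re ≤ B := (le_abs_self _).trans ((Complex.abs_re_le_norm u).trans hB)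
  have him : u.im ^ 2 ≤ B ^ 2 := by
    rw [← sq_abs]
    exact pow_le_pow_left₀ (abs_nonneg _) ((Complex.abs_im_le_norm u).trans hB) 2
  have e : (ζ ^ 2 * u).re = (ζ.re ^ 2 - ζ.im ^ 2) * u.re - 2 * ζ.re * ζ.im * u.im := by
    rw [sq, Complex.mul_re, Complex.mul_re, Complex.mul_im]; ring
  have h1 : 0 ≤ α / 2 * ζ.re ^ 2 - 2 * ζ.re * ζ.im * u.im + 2 / α * (ζ.im * u.im) ^ 2 := by
    have : α / 2 * ζ.re ^ 2 - 2 * ζ.re * ζ.im * u.im + 2 / α * (ζ.im * u.im) ^ 2 =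
        (α * ζ.re - 2 * (ζ.im * u.im)) ^ 2 / (2 * α) := by field_simp; ring
    rw [this]; positivity
  have h2 : 2 / α * (ζ.im * u.im) ^ 2 ≤ 2 * B ^ 2 / α * ζ.im ^ 2 := by
    calc 2 / α * (ζ.im * u.im) ^ 2 = 2 / α * ζ.im ^ 2 * u.im ^ 2 := by ring
      _ ≤ 2 / α * ζ.im ^ 2 * B ^ 2 := by gcongr
      _ = _ := by ring
  rw [e]
  nlinarith [mul_nonneg (sub_nonneg.2 hu) (sq_nonneg ζ.re),
    mul_nonneg (sub_nonneg.2 hre) (sq_nonneg ζ.im)]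

/-- A Gaussian is dominated by `1 / (1 + x²)`. -/
theorem exp_neg_mul_sub_sq_le {β m : ℝ} (hβ : 0 < β) (x : ℝ) :
    Real.exp (-(β * (x - m) ^ 2)) ≤ 2 * (1 + m ^ 2) * (1 + β⁻¹) / (1 + x ^ 2) := by
  have h1 : 1 + x ^ 2 ≤ 2 * (1 + m ^ 2) * (1 + (x - m) ^ 2) := by
    nlinarith [sq_nonneg (x - 2 * m), sq_nonneg (m * (x - m))]
  have h2 : 1 + (x - m) ^ 2 ≤ (1 + β⁻¹) * Real.exp (β * (x - m) ^ 2) := by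
    have h := Real.add_one_le_exp (β * (x - m) ^ 2)
    calc 1 + (x - m) ^ 2 ≤ (1 + β⁻¹) * (β * (x - m) ^ 2 + 1) := by
          have : (1 + β⁻¹) * (β * (x - m) ^ 2 + 1) =
            1 + (x - m) ^ 2 + (β * (x - m) ^ 2 + β⁻¹) := by field_simp; ring
          rw [this]
          have : 0 ≤ β * (x - m) ^ 2 + β⁻¹ := by positivity
          linarith
      _ ≤ _ := by gcongr
  rw [le_div_iff₀ (by positivity), Real.exp_neg, inv_mul_le_iff₀ (Real.exp_pos _)]
  calc 1 + x ^ 2 ≤ 2 * (1 + m ^ 2) * (1 + (x - m) ^ 2) := h1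
    _ ≤ 2 * (1 + m ^ 2) * ((1 + β⁻¹) * Real.exp (β * (x - m) ^ 2)) := by gcongr
    _ = _ := by ring

namespace StripExtension

variable {f g : ℝ → ℝ} {F W : ℂ → ℂ} {a h M₁ M₂ M₃ : ℝ}

theorem W_ne_zero (H : StripExtension f g F W a M₁ M₂ M₃) {z : ℂ} (hz : |z.im| ≤ a) : W z ≠ 0 :=
  norm_pos_iff.1 (H.M₂_pos.trans_le (H.le_norm_W z hz))

theorem le_abs_g (H : StripExtension f g F W a M₁ M₂ M₃) (x : ℝ) : M₂ ≤ |g x| := by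
  have := H.le_norm_W x (by simpa using H.nonneg)
  rwa [H.W_ofReal, Complex.norm_real, Real.norm_eq_abs, abs_abs] at this

theorem kernel_ofReal (H : StripExtension f g F W a M₁ M₂ M₃) (x y : ℝ) :
    kernel F W h x y = G f g h x y := by
  rw [kernel, G, H.F_ofReal, H.W_ofReal]
  have e : √(2 * Real.pi * g y ^ 2 * h) = √(2 * Real.pi * h) * |g y| := by
    rw [← Real.sqrt_sq_eq_abs, ← Real.sqrt_mul' _ (sq_nonneg _)]
    ring_nf
  rw [e, one_div, ← sq_abs (g y)]
  push_cast
  rfl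

theorem continuous_line_F (H : StripExtension f g F W a M₁ M₂ M₃) {b : ℝ} (hb : |b| ≤ a) :
    Continuous fun y : ℝ => F (y + b * Complex.I) :=
  continuous_iff_continuousAt.2 fun y =>
    ContinuousAt.comp (f := fun y : ℝ => (y + b * Complex.I : ℂ)) (g := F)
      (H.F_diff _ (by simpa using hb)).continuousAt (by fun_prop)

theorem continuous_line_W (H : StripExtension f g F W a M₁ M₂ M₃) {b : ℝ} (hb : |b| ≤ a) :
    Continuous fun y : ℝ => W (y + b * Complex.I) :=
  continuous_iff_continuousAt.2 fun y =>
    ContinuousAt.comp (f := fun y : ℝ => (y + b * Complex.I : ℂ)) (g := W)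
      (H.W_diff _ (by simpa using hb)).continuousAt (by fun_prop)

theorem continuous_f (H : StripExtension f g F W a M₁ M₂ M₃) : Continuous f := by
  have := Complex.continuous_re.comp (H.continuous_line_F (b := 0) (by simpa using H.nonneg))
  simpa [Function.comp_def, H.F_ofReal] using this

theorem continuous_kernel_line (H : StripExtension f g F W a M₁ M₂ M₃) (hh : 0 < h) {b c : ℝ}
    (hb : |b| ≤ a) :
    Continuous fun p : ℝ × ℝ => kernel F W h (p.1 + c * Complex.I) (p.2 + b * Complex.I) := by
  have cF := (H.continuous_line_F hb).comp (continuous_snd (X := ℝ))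
  have cW := (H.continuous_line_W hb).comp (continuous_snd (X := ℝ))
  simp only [Function.comp_def] at cF cW
  have hW : ∀ p : ℝ × ℝ, W (p.2 + b * Complex.I) ≠ 0 := fun p =>
    H.W_ne_zero (by simpa using hb)
  have h0 : (h : ℂ) ≠ 0 := by exact_mod_cast hh.ne'
  have hs : ((√(2 * Real.pi * h) : ℝ) : ℂ) ≠ 0 := by
    have : 0 < √(2 * Real.pi * h) := by positivity
    exact_mod_cast this.ne'
  unfold kernel
  refine Continuous.mul (Continuous.inv₀ (continuous_const.mul cW) fun p =>
    mul_ne_zero hs (hW p)) ?_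
  refine Complex.continuous_exp.comp (Continuous.neg (Continuous.div
    (((by fun_prop : Continuous fun p : ℝ × ℝ =>
      (p.1 + c * Complex.I - (p.2 + b * Complex.I) : ℂ)).sub (cF.mul continuous_const)).pow 2)
    ((continuous_const.mul (cW.pow 2)).mul continuous_const) fun p => ?_))
  exact mul_ne_zero (mul_ne_zero two_ne_zero (pow_ne_zero _ (hW p))) h0

theorem differentiableAt_kernel_right (H : StripExtension f g F W a M₁ M₂ M₃) (hh : 0 < h) (x : ℂ)
    {z : ℂ} (hz : |z.im| ≤ a) : DifferentiableAt ℂ (fun z => kernel F W h x z) z := by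
  have dF := H.F_diff z hz
  have dW := H.W_diff z hz
  have hW := H.W_ne_zero hz
  have h0 : (h : ℂ) ≠ 0 := by exact_mod_cast hh.ne'
  have hs : ((√(2 * Real.pi * h) : ℝ) : ℂ) ≠ 0 := by
    have : 0 < √(2 * Real.pi * h) := by positivity
    exact_mod_cast this.ne'
  unfold kernel
  refine DifferentiableAt.mul (DifferentiableAt.inv (by fun_prop) (mul_ne_zero hs hW)) ?_
  refine DifferentiableAt.cexp (DifferentiableAt.neg (DifferentiableAt.div (by fun_prop)
    (by fun_prop) ?_))
  exact mul_ne_zero (mul_ne_zero two_ne_zero (pow_ne_zero _ hW)) h0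

/-- The Gaussian majorant of the continued kernel. The imaginary part of `x - z - F z h` is at most
`(2 + M₁ h) a`, which is of the order of the standard deviation `√h` when `a` is. -/
theorem norm_kernel_le (H : StripExtension f g F W a M₁ M₂ M₃) (hh : 0 < h) {R L : ℝ}
    (haR : a ^ 2 ≤ R * h) (hL : M₁ * h ≤ L) {x b : ℝ} {z : ℂ} (hb : |b| ≤ a) (hz : |z.im| ≤ a) :
    ‖kernel F W h (x + b * Complex.I) z‖ ≤ (√(2 * Real.pi * h) * M₂)⁻¹ *
      Real.exp (((M₂ ^ 2)⁻¹ + 2 * (M₂ ^ 2)⁻¹ ^ 2 / (M₂ ^ 2 / (2 * M₃ ^ 4))) *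
        (R * (2 + L) ^ 2) / 2) *
      Real.exp (-(M₂ ^ 2 / (2 * M₃ ^ 4) / (4 * h) * (x - (z.re + (F z).re * h)) ^ 2)) := by
  have p1 := H.M₁_pos
  have p2 := H.M₂_pos
  have p3 := H.M₃_pos
  have pa := H.nonneg
  set α := M₂ ^ 2 / (2 * M₃ ^ 4) with hα
  set Λ := (M₂ ^ 2)⁻¹ + 2 * (M₂ ^ 2)⁻¹ ^ 2 / α with hΛ
  have hα0 : 0 < α := by positivity
  have hΛ0 : 0 < Λ := by positivity
  have hWl := H.le_norm_W z hz
  have hWu := H.norm_W_le z hz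
  have hW := H.W_ne_zero hz
  set V := W z ^ 2 with hV
  have hVl : M₂ ^ 2 ≤ ‖V‖ := by rw [hV, norm_pow]; gcongr
  have hVu : ‖V‖ ≤ M₃ ^ 2 := by rw [hV, norm_pow]; gcongr
  have hV0 : 0 < ‖V‖ := lt_of_lt_of_le (by positivity) hVl
  have hu : α ≤ (V⁻¹).re := by
    rw [Complex.inv_re, Complex.normSq_eq_norm_sq, hα]
    calc M₂ ^ 2 / (2 * M₃ ^ 4) = M₂ ^ 2 / 2 / (M₃ ^ 2) ^ 2 := by field_simp
      _ ≤ V.re / ‖V‖ ^ 2 := by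
        have := H.le_re_W_sq z hz
        have : 0 ≤ V.re := le_trans (by positivity) this
        gcongr
  have huB : ‖V⁻¹‖ ≤ (M₂ ^ 2)⁻¹ := by
    rw [norm_inv]; gcongr
  set ζ : ℂ := x + b * Complex.I - z - F z * h with hζ
  have hζre : ζ.re = x - (z.re + (F z).re * h) := by simp [hζ]; ring
  have hζim : ζ.im ^ 2 ≤ R * h * (2 + L) ^ 2 := by
    have e : ζ.im = b - z.im - (F z).im * h := by simp [hζ]
    have hF := H.abs_im_F_le z hz
    have h1 : |ζ.im| ≤ a * (2 + L) := by
      rw [e]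
      calc |b - z.im - (F z).im * h| ≤ |b| + |z.im| + |(F z).im * h| :=
            (abs_sub _ _).trans (by gcongr; exact abs_sub _ _)
        _ ≤ a + a + M₁ * a * h := by
            rw [abs_mul, abs_of_pos hh]; gcongr
        _ = a * (2 + M₁ * h) := by ring
        _ ≤ a * (2 + L) := by gcongr
    calc ζ.im ^ 2 = |ζ.im| ^ 2 := (sq_abs _).symm
      _ ≤ (a * (2 + L)) ^ 2 := by gcongr
      _ = a ^ 2 * (2 + L) ^ 2 := by ring
      _ ≤ _ := by gcongr
  have hq := le_re_sq_mul (ζ := ζ) hα0 hu huB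
  have hexp : (-(ζ ^ 2 / (2 * V * h))).re ≤
      Λ * (R * (2 + L) ^ 2) / 2 + -(α / (4 * h) * ζ.re ^ 2) := by
    have e : -(ζ ^ 2 / (2 * V * h)) = ((-(1 / (2 * h)) : ℝ) : ℂ) * (ζ ^ 2 * V⁻¹) := by
      have h0 : (h : ℂ) ≠ 0 := by exact_mod_cast hh.ne'
      have hV0' : V ≠ 0 := norm_pos_iff.1 hV0
      push_cast
      field_simp
    rw [e, Complex.re_ofReal_mul]
    have h2 : α / 2 * ζ.re ^ 2 - Λ * (R * h * (2 + L) ^ 2) ≤ (ζ ^ 2 * V⁻¹).re := by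
      refine le_trans ?_ hq
      gcongr
    calc -(1 / (2 * h)) * (ζ ^ 2 * V⁻¹).re
        ≤ -(1 / (2 * h)) * (α / 2 * ζ.re ^ 2 - Λ * (R * h * (2 + L) ^ 2)) := by
          rw [neg_mul, neg_mul, neg_le_neg_iff]
          gcongr
      _ = _ := by field_simp; ring
  rw [kernel, norm_mul, Complex.norm_exp, norm_inv, norm_mul, Complex.norm_real,
    Real.norm_of_nonneg (Real.sqrt_nonneg _), mul_assoc _ (Real.exp _) (Real.exp _), ← Real.exp_add]
  refine mul_le_mul ?_ ?_ (Real.exp_nonneg _) (by positivity)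
  · gcongr
  · rw [← hζre]; exact Real.exp_le_exp.2 hexp

/-- The continued kernel is bounded in `L¹`, uniformly in `h`, on strips of width of order
`√h`. -/
theorem exists_lintegral_kernel_le {M₁ M₂ M₃ : ℝ} (h2 : 0 < M₂) (h3 : 0 < M₃) (R L : ℝ) :
    ∃ A : ℝ, 0 < A ∧ ∀ (f g : ℝ → ℝ) (F W : ℂ → ℂ) (a h : ℝ),
      StripExtension f g F W a M₁ M₂ M₃ → 0 < h → a ^ 2 ≤ R * h → M₁ * h ≤ L →
      ∀ (b : ℝ) (z : ℂ), |b| ≤ a → |z.im| ≤ a →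
        ∫⁻ x : ℝ, ‖kernel F W h (x + b * Complex.I) z‖ₑ ≤ ENNReal.ofReal A := by
  set α := M₂ ^ 2 / (2 * M₃ ^ 4) with hα
  have hα0 : 0 < α := by positivity
  set E := Real.exp (((M₂ ^ 2)⁻¹ + 2 * (M₂ ^ 2)⁻¹ ^ 2 / α) * (R * (2 + L) ^ 2) / 2) with hE
  refine ⟨E * √(2 / α) / M₂, by positivity, fun f g F W a h H hh haR hL b z hb hz => ?_⟩
  set c := (√(2 * Real.pi * h) * M₂)⁻¹ * E with hc
  set m := z.re + (F z).re * h with hm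
  have hβ : 0 < α / (4 * h) := by positivity
  have hint : Integrable fun x : ℝ => c * Real.exp (-(α / (4 * h) * (x - m) ^ 2)) := by
    simpa [neg_mul] using ((integrable_exp_neg_mul_sq hβ).comp_sub_right m).const_mul c
  calc ∫⁻ x : ℝ, ‖kernel F W h (x + b * Complex.I) z‖ₑ
      ≤ ∫⁻ x : ℝ, ENNReal.ofReal (c * Real.exp (-(α / (4 * h) * (x - m) ^ 2))) := by
        refine lintegral_mono fun x => ?_
        rw [← ofReal_norm]
        exact ENNReal.ofReal_le_ofReal (H.norm_kernel_le hh haR hL hb hz)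
    _ = ENNReal.ofReal (∫ x : ℝ, c * Real.exp (-(α / (4 * h) * (x - m) ^ 2))) :=
        (ofReal_integral_eq_lintegral_ofReal hint
          (Eventually.of_forall fun x => by positivity)).symm
    _ = _ := by
      congr 1
      have e := integral_sub_right_eq_self (μ := volume)
        (fun x : ℝ => Real.exp (-(α / (4 * h)) * x ^ 2)) m
      rw [integral_gaussian] at e
      simp only [neg_mul] at e
      have e2 : √(Real.pi / (α / (4 * h))) = √(2 * Real.pi * h) * √(2 / α) := by
        rw [← Real.sqrt_mul (by positivity)]
        congr 1
        field_simp
        ring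
      rw [integral_const_mul, e, e2, hc]
      have : √(2 * Real.pi * h) ≠ 0 := by positivity
      field_simp

end StripExtension

end DTQ

/-! ### Quadrature errors of the transition density -/

namespace DTQ

theorem measurable_tsum_of_nonneg {ι α : Type*} [Countable ι] [MeasurableSpace α] {u : ι → α → ℝ}
    (hm : ∀ i, Measurable (u i)) (h0 : ∀ i x, 0 ≤ u i x) (hs : ∀ x, Summable fun i => u i x) :
    Measurable fun x => ∑' i, u i x := by
  have e : (fun x => ∑' i, u i x) = fun x => (∑' i, ENNReal.ofReal (u i x)).toReal := by
    ext x
    rw [← ENNReal.ofReal_tsum_of_nonneg (fun i => h0 i x) (hs x),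
      ENNReal.toReal_ofReal (tsum_nonneg fun i => h0 i x)]
  rw [e]
  exact (Measurable.tsum fun i => (hm i).ennreal_ofReal).ennreal_toReal

/-- A bounded transition density `Γ x y` (a probability density in `x`) together with quantitative
accuracy of the trapezoidal rule with step `k`: the grid mass of each density `Γ · s` is at most
`1 + δ`, and replacing the integral by the rule in the two-step density changes it by at most `η`
in `L¹`. -/
structure QuadratureKernel (Γ : ℝ → ℝ → ℝ) (k B δ η : ℝ) : Prop where
  nonneg : ∀ x y, 0 ≤ Γ x y
  le_bound : ∀ x y, Γ x y ≤ B
  measurable : Measurable (Function.uncurry Γ)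
  lintegral_eq_one : ∀ y, ∫⁻ x, ENNReal.ofReal (Γ x y) = 1
  k_pos : 0 < k
  summable_grid : ∀ s, Summable fun n : ℤ => Γ (n * k) s
  grid_mass_le : ∀ s, k * ∑' n : ℤ, Γ (n * k) s ≤ 1 + δ
  error_le : ∀ s, ∫⁻ x, ‖(k * ∑' n : ℤ, Γ x (n * k) * Γ (n * k) s) - ∫ y, Γ x y * Γ y s‖ₑ ≤
    ENNReal.ofReal η

theorem G_nonneg (f g : ℝ → ℝ) (h x y : ℝ) : 0 ≤ G f g h x y := by
  unfold G
  positivity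

theorem G_eq_gaussianPDFReal (f g : ℝ → ℝ) {h : ℝ} (hh : 0 ≤ h) (x y : ℝ) :
    G f g h x y = gaussianPDFReal (y + f y * h) (g y ^ 2 * h).toNNReal x := by
  rw [G, gaussianPDFReal, one_div, Real.coe_toNNReal _ (by positivity)]
  congr 2
  · ring_nf
  · rw [neg_div]
    ring_nf

theorem continuous_kernel_left (F W : ℂ → ℂ) (h b s : ℝ) :
    Continuous fun x : ℝ => kernel F W h (x + b * Complex.I) s :=
  (differentiable_kernel_left F W h s).continuous.comp (by fun_prop)

theorem sub_mul_I (x b : ℝ) : (x - b * Complex.I : ℂ) = x + (-b : ℝ) * Complex.I := by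
  push_cast
  ring

namespace StripExtension

variable {f g : ℝ → ℝ} {F W : ℂ → ℂ} {a h M₁ M₂ M₃ : ℝ}

theorem g_ne_zero (H : StripExtension f g F W a M₁ M₂ M₃) (x : ℝ) : g x ≠ 0 :=
  abs_pos.1 (H.M₂_pos.trans_le (H.le_abs_g x))

theorem G_le (H : StripExtension f g F W a M₁ M₂ M₃) (hh : 0 < h) (x y : ℝ) :
    G f g h x y ≤ (√(2 * Real.pi * h) * M₂)⁻¹ := by
  have p2 := H.M₂_pos
  have e : √(2 * Real.pi * g y ^ 2 * h) = √(2 * Real.pi * h) * |g y| := by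
    rw [← Real.sqrt_sq_eq_abs, ← Real.sqrt_mul' _ (sq_nonneg _)]
    ring_nf
  have h1 : Real.exp (-((x - y - f y * h) ^ 2 / (2 * g y ^ 2 * h))) ≤ 1 := by
    rw [Real.exp_le_one_iff, neg_nonpos]
    positivity
  have h2 := H.le_abs_g y
  rw [G, e, one_div]
  calc _ ≤ (√(2 * Real.pi * h) * |g y|)⁻¹ * 1 := by gcongr
    _ ≤ _ := by
      rw [mul_one]
      gcongr

theorem measurable_G (H : StripExtension f g F W a M₁ M₂ M₃) (hh : 0 < h) :
    Measurable (Function.uncurry (G f g h)) := by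
  have := Complex.continuous_re.comp (H.continuous_kernel_line hh (b := 0) (c := 0)
    (by simpa using H.nonneg))
  simp only [Function.comp_def, Complex.ofReal_zero, zero_mul, add_zero, H.kernel_ofReal,
    Complex.ofReal_re] at this
  exact this.measurable

theorem lintegral_G (H : StripExtension f g F W a M₁ M₂ M₃) (hh : 0 < h) (y : ℝ) :
    ∫⁻ x, ENNReal.ofReal (G f g h x y) = 1 := by
  have hv : (g y ^ 2 * h).toNNReal ≠ 0 := by
    have := H.g_ne_zero y
    exact (Real.toNNReal_pos.2 (by positivity)).ne'
  simpa only [G_eq_gaussianPDFReal f g hh.le] using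
    lintegral_gaussianPDFReal_eq_one (y + f y * h) hv

theorem exists_norm_kernel_left_le (H : StripExtension f g F W a M₁ M₂ M₃) (hh : 0 < h) (s : ℝ) :
    ∃ A : ℝ, 0 ≤ A ∧ ∀ z : ℂ, |z.im| ≤ a → ‖kernel F W h z s‖ ≤ A / (1 + z.re ^ 2) := by
  have p2 := H.M₂_pos
  have p3 := H.M₃_pos
  have hs : |(s : ℂ).im| ≤ a := by simpa using H.nonneg
  have key := fun (z : ℂ) (hz : |z.im| ≤ a) => H.norm_kernel_le hh (R := a ^ 2 / h) (L := M₁ * h)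
    (by rw [div_mul_cancel₀ _ hh.ne']) le_rfl (x := z.re) hz hs
  simp only [Complex.re_add_im] at key
  have hβ : 0 < M₂ ^ 2 / (2 * M₃ ^ 4) / (4 * h) := by positivity
  refine ⟨_, ?_, fun z hz => (key z hz).trans ((mul_le_mul_of_nonneg_left
    (exp_neg_mul_sub_sq_le hβ z.re) (by positivity)).trans (le_of_eq (mul_div_assoc _ _ _).symm))⟩
  positivity

theorem exists_norm_kernel_le (H : StripExtension f g F W a M₁ M₂ M₃) (hh : 0 < h) :
    ∃ A : ℝ, 0 ≤ A ∧ ∀ (x : ℝ) (z : ℂ), |z.im| ≤ a → ‖kernel F W h x z‖ ≤ A := by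
  have p2 := H.M₂_pos
  have p3 := H.M₃_pos
  have key := fun (x : ℝ) (z : ℂ) (hz : |z.im| ≤ a) => H.norm_kernel_le hh (R := a ^ 2 / h)
    (L := M₁ * h) (by rw [div_mul_cancel₀ _ hh.ne']) le_rfl (x := x) (b := 0)
    (by simpa using H.nonneg) hz
  simp only [Complex.ofReal_zero, zero_mul, add_zero] at key
  refine ⟨_, ?_, fun x z hz => (key x z hz).trans (mul_le_of_le_one_right (by positivity) ?_)⟩
  · positivity
  · rw [Real.exp_le_one_iff, neg_nonpos]
    positivity

/-- The grid mass of a transition density differs from its total mass by the error of the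
trapezoidal rule. -/
theorem grid_mass_G (H : StripExtension f g F W a M₁ M₂ M₃) (hh : 0 < h) (ha : 0 < a) {k A : ℝ}
    (hk : 0 < k) (hA0 : 0 ≤ A)
    (hA : ∀ (b : ℝ) (z : ℂ), |b| ≤ a → |z.im| ≤ a →
      ∫⁻ x : ℝ, ‖kernel F W h (x + b * Complex.I) z‖ₑ ≤ ENNReal.ofReal A) (s : ℝ) :
    (Summable fun n : ℤ => G f g h (n * k) s) ∧
      k * ∑' n : ℤ, G f g h (n * k) s ≤ 1 + 2 * A / (Real.exp (2 * Real.pi * a / k) - 1) := by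
  obtain ⟨D, hD0, hD⟩ := H.exists_norm_kernel_left_le hh s
  have hs : |(s : ℂ).im| ≤ a := by simpa using ha.le
  have hcast : ∀ n : ℤ, kernel F W h (n * k) s = (G f g h (n * k) s : ℝ) := fun n => by
    rw [← H.kernel_ofReal]
    push_cast
    rfl
  constructor
  · refine summable_of_norm_le_div_one_add_sq (A := D * (1 + (k ^ 2)⁻¹)) (by positivity)
      fun n => ?_
    have h1 := hD (n * k) (by simp [ha.le])
    rw [hcast, Complex.norm_real] at h1
    refine h1.trans ?_
    have e : ((n : ℂ) * k).re = n * k := by simp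
    rw [e, div_le_div_iff₀ (by positivity) (by positivity), mul_assoc]
    gcongr
    have : (1 + (k ^ 2)⁻¹) * (1 + ((n : ℝ) * k) ^ 2) =
        1 + (n : ℝ) ^ 2 + ((k ^ 2)⁻¹ + (n : ℝ) ^ 2 * k ^ 2) := by field_simp; ring
    rw [this]
    have : 0 ≤ (k ^ 2)⁻¹ + (n : ℝ) ^ 2 * k ^ 2 := by positivity
    linarith
  · have main := norm_mul_tsum_sub_integral_le (φ := fun z => kernel F W h z s) ha hk
      (fun z _ => differentiable_kernel_left F W h _ z) hD
    have hedge : ∀ b : ℝ, |b| ≤ a → ∫ x : ℝ, ‖kernel F W h (x + b * Complex.I) s‖ ≤ A := by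
      intro b hb
      rw [integral_norm_eq_lintegral_enorm (continuous_kernel_left F W h b s).aestronglyMeasurable]
      exact ENNReal.toReal_le_of_le_ofReal hA0 (hA b s hb hs)
    have e1 : ∫ x : ℝ, G f g h x s = 1 := by
      rw [integral_eq_lintegral_of_nonneg_ae (Eventually.of_forall fun x => G_nonneg f g h x s)
        ((H.measurable_G hh).comp (measurable_id.prodMk measurable_const)).aestronglyMeasurable,
        H.lintegral_G hh]
      simp
    have e2 : (k : ℂ) * ∑' n : ℤ, kernel F W h (n * k) s - ∫ x : ℝ, kernel F W h x s =
        ((k * ∑' n : ℤ, G f g h (n * k) s - 1 : ℝ) : ℂ) := by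
      simp_rw [hcast, H.kernel_ofReal]
      rw [integral_complex_ofReal, e1]
      push_cast
      rfl
    rw [e2, Complex.norm_real] at main
    have hexp : 0 < Real.exp (2 * Real.pi * a / k) - 1 := by
      rw [sub_pos, Real.one_lt_exp_iff]; positivity
    have h3 := (le_abs_self _).trans main
    simp only [sub_mul_I] at h3
    have h4 : k * ∑' n : ℤ, G f g h (n * k) s - 1 ≤
        (A + A) / (Real.exp (2 * Real.pi * a / k) - 1) := by
      refine h3.trans ?_
      gcongr
      · exact hedge a (abs_of_pos ha).le
      · exact hedge (-a) (by rw [abs_neg, abs_of_pos ha])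
    rw [← two_mul] at h4
    linarith

/-- The trapezoidal rule in the two-step density: for fixed `x` and `s` the integrand
`y ↦ G(x, y) G(y, s)` is holomorphic in the strip; the bound on the edges is integrated over `x`
with Tonelli's theorem. -/
theorem lintegral_two_step_error (H : StripExtension f g F W a M₁ M₂ M₃) (hh : 0 < h) (ha : 0 < a)
    {k A : ℝ} (hk : 0 < k) (hA0 : 0 ≤ A)
    (hA : ∀ (b : ℝ) (z : ℂ), |b| ≤ a → |z.im| ≤ a →
      ∫⁻ x : ℝ, ‖kernel F W h (x + b * Complex.I) z‖ₑ ≤ ENNReal.ofReal A) (s : ℝ) :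
    ∫⁻ x, ‖(k * ∑' n : ℤ, G f g h x (n * k) * G f g h (n * k) s) -
        ∫ y, G f g h x y * G f g h y s‖ₑ ≤
      ENNReal.ofReal (2 * A ^ 2 / (Real.exp (2 * Real.pi * a / k) - 1)) := by
  obtain ⟨D, hD0, hD⟩ := H.exists_norm_kernel_left_le hh s
  obtain ⟨D', hD'0, hD'⟩ := H.exists_norm_kernel_le hh
  have hs : |(s : ℂ).im| ≤ a := by simpa using ha.le
  have hexp : 0 < Real.exp (2 * Real.pi * a / k) - 1 := by
    rw [sub_pos, Real.one_lt_exp_iff]; positivity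
  set q : ℝ := (Real.exp (2 * Real.pi * a / k) - 1)⁻¹ with hq
  have hq0 : 0 < q := inv_pos.2 hexp
  set J : ℝ → ℝ → ENNReal := fun b x =>
    ∫⁻ y : ℝ, ‖kernel F W h x (y + b * Complex.I)‖ₑ * ‖kernel F W h (y + b * Complex.I) s‖ₑ with hJ
  have hpt : ∀ x : ℝ, ‖(k * ∑' n : ℤ, G f g h x (n * k) * G f g h (n * k) s) -
      ∫ y, G f g h x y * G f g h y s‖ₑ ≤ ENNReal.ofReal q * (J a x + J (-a) x) := by
    intro x
    have main := norm_mul_tsum_sub_integral_le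
      (φ := fun z => kernel F W h x z * kernel F W h z s) (A := D' * D) ha hk
      (fun z hz => (H.differentiableAt_kernel_right hh x hz).mul
        (differentiable_kernel_left F W h _ z)) (fun z hz => by
        rw [norm_mul, mul_div_assoc]
        exact mul_le_mul (hD' x z hz) (hD z hz) (norm_nonneg _) hD'0)
    have e2 : (k : ℂ) * ∑' n : ℤ, kernel F W h x (n * k) * kernel F W h (n * k) s -
        ∫ y : ℝ, kernel F W h x y * kernel F W h y s =
        (((k * ∑' n : ℤ, G f g h x (n * k) * G f g h (n * k) s) -
          ∫ y, G f g h x y * G f g h y s : ℝ) : ℂ) := by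
      have h1 : ∀ n : ℤ, kernel F W h x (n * k) * kernel F W h (n * k) s =
          ((G f g h x (n * k) * G f g h (n * k) s : ℝ) : ℂ) := fun n => by
        rw [← Complex.ofReal_intCast, ← Complex.ofReal_mul, H.kernel_ofReal, H.kernel_ofReal]
        push_cast
        rfl
      have h2 : ∀ y : ℝ, kernel F W h x y * kernel F W h y s =
          ((G f g h x y * G f g h y s : ℝ) : ℂ) := fun y => by
        rw [H.kernel_ofReal, H.kernel_ofReal]
        push_cast
        rfl
      simp_rw [h1, h2]
      rw [integral_complex_ofReal, ← Complex.ofReal_tsum]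
      push_cast
      rfl
    rw [e2, Complex.norm_real] at main
    have hedge : ∀ b : ℝ, ENNReal.ofReal (∫ y : ℝ,
        ‖kernel F W h x (y + b * Complex.I) * kernel F W h (y + b * Complex.I) s‖) ≤ J b x := by
      intro b
      calc _ ≤ ‖∫ y : ℝ,
            ‖kernel F W h x (y + b * Complex.I) * kernel F W h (y + b * Complex.I) s‖‖ₑ :=
            Real.ofReal_le_enorm _
        _ ≤ _ := enorm_integral_le_lintegral_enorm _
        _ = J b x := by simp only [enorm_norm, enorm_mul, hJ]
    rw [← ofReal_norm]
    refine (ENNReal.ofReal_le_ofReal main).trans ?_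
    rw [div_eq_inv_mul, ENNReal.ofReal_mul hq0.le]
    gcongr
    simp only [sub_mul_I]
    refine ENNReal.ofReal_add_le.trans ?_
    gcongr
    · exact hedge a
    · exact hedge (-a)
  have hmeas : ∀ b : ℝ, |b| ≤ a → Measurable fun p : ℝ × ℝ =>
      ‖kernel F W h p.1 (p.2 + b * Complex.I)‖ₑ * ‖kernel F W h (p.2 + b * Complex.I) s‖ₑ := by
    intro b hb
    have c1 := H.continuous_kernel_line hh (c := 0) hb
    simp only [Complex.ofReal_zero, zero_mul, add_zero] at c1
    have c2 := (continuous_kernel_left F W h b s).comp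
      (continuous_snd (X := ℝ))
    exact c1.measurable.enorm.mul c2.measurable.enorm
  have hJint : ∀ b : ℝ, |b| ≤ a → ∫⁻ x, J b x ≤ ENNReal.ofReal (A ^ 2) := by
    intro b hb
    rw [hJ, lintegral_lintegral_swap (hmeas b hb).aemeasurable]
    calc ∫⁻ y : ℝ, ∫⁻ x : ℝ, ‖kernel F W h x (y + b * Complex.I)‖ₑ *
          ‖kernel F W h (y + b * Complex.I) s‖ₑ
        ≤ ∫⁻ y : ℝ, ENNReal.ofReal A * ‖kernel F W h (y + b * Complex.I) s‖ₑ := by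
          refine lintegral_mono fun y => ?_
          rw [lintegral_mul_const' _ _ enorm_ne_top]
          gcongr
          simpa using hA 0 (y + b * Complex.I) (by simpa using ha.le) (by simpa using hb)
      _ = ENNReal.ofReal A * ∫⁻ y : ℝ, ‖kernel F W h (y + b * Complex.I) s‖ₑ :=
          lintegral_const_mul' _ _ ENNReal.ofReal_ne_top
      _ ≤ ENNReal.ofReal A * ENNReal.ofReal A := by
          gcongr
          exact hA b s hb hs
      _ = _ := by rw [← ENNReal.ofReal_mul hA0, sq]
  have ha1 : |a| ≤ a := (abs_of_pos ha).le
  have ha2 : |-a| ≤ a := by rw [abs_neg, abs_of_pos ha]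
  calc _ ≤ ∫⁻ x, ENNReal.ofReal q * (J a x + J (-a) x) := lintegral_mono hpt
    _ = ENNReal.ofReal q * ((∫⁻ x, J a x) + ∫⁻ x, J (-a) x) := by
      rw [lintegral_const_mul' _ _ ENNReal.ofReal_ne_top,
        lintegral_add_left (hmeas a ha1).lintegral_prod_right']
    _ ≤ ENNReal.ofReal q * (ENNReal.ofReal (A ^ 2) + ENNReal.ofReal (A ^ 2)) := by
      gcongr
      · exact hJint a ha1
      · exact hJint (-a) ha2
    _ = _ := by
      rw [← ENNReal.ofReal_add (by positivity) (by positivity), ← ENNReal.ofReal_mul hq0.le, hq]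
      congr 1
      ring

theorem quadratureKernel (H : StripExtension f g F W a M₁ M₂ M₃) (hh : 0 < h) (ha : 0 < a)
    {k A : ℝ} (hk : 0 < k) (hA0 : 0 ≤ A)
    (hA : ∀ (b : ℝ) (z : ℂ), |b| ≤ a → |z.im| ≤ a →
      ∫⁻ x : ℝ, ‖kernel F W h (x + b * Complex.I) z‖ₑ ≤ ENNReal.ofReal A) :
    QuadratureKernel (G f g h) k (√(2 * Real.pi * h) * M₂)⁻¹
      (2 * A / (Real.exp (2 * Real.pi * a / k) - 1))
      (2 * A ^ 2 / (Real.exp (2 * Real.pi * a / k) - 1)) where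
  nonneg := G_nonneg f g h
  le_bound := H.G_le hh
  measurable := H.measurable_G hh
  lintegral_eq_one := H.lintegral_G hh
  k_pos := hk
  summable_grid s := (H.grid_mass_G hh ha hk hA0 hA s).1
  grid_mass_le s := (H.grid_mass_G hh ha hk hA0 hA s).2
  error_le s := H.lintegral_two_step_error hh ha hk hA0 hA s

end StripExtension

end DTQ

/-! ### Propagation of the error -/

namespace DTQ

/-- `p` is a countable superposition, of total weight at most `S`, of the transition densities
`Γ · s`. -/
def IsMixture (Γ : ℝ → ℝ → ℝ) (p : ℝ → ℝ) (S : ℝ) : Prop :=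
  ∃ w s : ℤ → ℝ, (∀ i, 0 ≤ w i) ∧ Summable w ∧ ∑' i, w i ≤ S ∧ ∀ y, p y = ∑' i, w i * Γ y (s i)

/-- The densities of the chain with transition density `Γ` started at `C`, after `n + 1` steps. -/
noncomputable def chainDensity (Γ : ℝ → ℝ → ℝ) (C : ℝ) : ℕ → ℝ → ℝ
  | 0, x => Γ x C
  | n + 1, x => ∫ y, Γ x y * chainDensity Γ C n y

/-- The approximation of `chainDensity` with each integral replaced by the trapezoidal rule. -/
noncomputable def gridDensity (Γ : ℝ → ℝ → ℝ) (C k : ℝ) : ℕ → ℝ → ℝ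
  | 0, x => Γ x C
  | n + 1, x => k * ∑' j : ℤ, Γ x (j * k) * gridDensity Γ C k n (j * k)

namespace QuadratureKernel

variable {Γ : ℝ → ℝ → ℝ} {k B δ η S C : ℝ} {p : ℝ → ℝ}

theorem measurable_left (Q : QuadratureKernel Γ k B δ η) (y : ℝ) : Measurable fun x => Γ x y :=
  Q.measurable.comp (measurable_id.prodMk measurable_const)

theorem measurable_right (Q : QuadratureKernel Γ k B δ η) (x : ℝ) : Measurable fun y => Γ x y :=
  Q.measurable.comp (measurable_const.prodMk measurable_id)

theorem lintegral_enorm (Q : QuadratureKernel Γ k B δ η) (y : ℝ) : ∫⁻ x, ‖Γ x y‖ₑ = 1 := by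
  simp_rw [Real.enorm_of_nonneg (Q.nonneg _ y)]
  exact Q.lintegral_eq_one y

theorem integrable_left (Q : QuadratureKernel Γ k B δ η) (y : ℝ) : Integrable fun x => Γ x y :=
  ⟨(Q.measurable_left y).aestronglyMeasurable, by
    rw [HasFiniteIntegral, Q.lintegral_enorm]; exact ENNReal.one_lt_top⟩

theorem integral_left (Q : QuadratureKernel Γ k B δ η) (y : ℝ) : ∫ x, Γ x y = 1 := by
  rw [integral_eq_lintegral_of_nonneg_ae (Eventually.of_forall fun x => Q.nonneg x y)
    (Q.measurable_left y).aestronglyMeasurable, Q.lintegral_eq_one]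
  simp

theorem integrable_mul (Q : QuadratureKernel Γ k B δ η) {u : ℝ → ℝ} (hu : Integrable u) (x : ℝ) :
    Integrable fun y => Γ x y * u y :=
  hu.bdd_mul (c := B) (Q.measurable_right x).aestronglyMeasurable
    (Eventually.of_forall fun y => by
      rw [Real.norm_of_nonneg (Q.nonneg x y)]; exact Q.le_bound x y)

/-- Integration against a transition density is a contraction of `L¹`. -/
theorem integrable_transition (Q : QuadratureKernel Γ k B δ η) {u : ℝ → ℝ} (hm : Measurable u)
    (hu : Integrable u) :
    Measurable (fun x => ∫ y, Γ x y * u y) ∧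
      ∫⁻ x, ‖∫ y, Γ x y * u y‖ₑ ≤ ∫⁻ y, ‖u y‖ₑ ∧
      Integrable fun x => ∫ y, Γ x y * u y := by
  have hmm : Measurable fun q : ℝ × ℝ => Γ q.1 q.2 * u q.2 :=
    Q.measurable.mul (hm.comp measurable_snd)
  have h1 : Measurable fun x => ∫ y, Γ x y * u y :=
    hmm.stronglyMeasurable.integral_prod_right'.measurable
  have h2 : ∫⁻ x, ‖∫ y, Γ x y * u y‖ₑ ≤ ∫⁻ y, ‖u y‖ₑ := by
    calc ∫⁻ x, ‖∫ y, Γ x y * u y‖ₑ ≤ ∫⁻ x, ∫⁻ y, ‖Γ x y * u y‖ₑ :=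
          lintegral_mono fun x => enorm_integral_le_lintegral_enorm _
      _ = ∫⁻ y, ∫⁻ x, ‖Γ x y * u y‖ₑ := lintegral_lintegral_swap hmm.enorm.aemeasurable
      _ = ∫⁻ y, ‖u y‖ₑ := by
        refine lintegral_congr fun y => ?_
        simp_rw [enorm_mul]
        rw [lintegral_mul_const' _ _ enorm_ne_top, Q.lintegral_enorm, one_mul]
  exact ⟨h1, h2, h1.aestronglyMeasurable, h2.trans_lt hu.2⟩

theorem summable_mul (Q : QuadratureKernel Γ k B δ η) {w : ℤ → ℝ} (h0 : ∀ i, 0 ≤ w i)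
    (hw : Summable w) (s : ℤ → ℝ) (y : ℝ) : Summable fun i => w i * Γ y (s i) :=
  Summable.of_nonneg_of_le (fun i => mul_nonneg (h0 i) (Q.nonneg _ _))
    (fun i => mul_le_mul_of_nonneg_left (Q.le_bound _ _) (h0 i)) (hw.mul_right B)

theorem mixture_nonneg (Q : QuadratureKernel Γ k B δ η) (hp : IsMixture Γ p S) (y : ℝ) :
    0 ≤ p y := by
  obtain ⟨w, s, h0, -, -, he⟩ := hp
  rw [he]
  exact tsum_nonneg fun i => mul_nonneg (h0 i) (Q.nonneg _ _)

theorem measurable_mixture (Q : QuadratureKernel Γ k B δ η) (hp : IsMixture Γ p S) :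
    Measurable p := by
  obtain ⟨w, s, h0, hw, -, he⟩ := hp
  rw [funext he]
  exact measurable_tsum_of_nonneg (fun i => (Q.measurable_left _).const_mul _)
    (fun i y => mul_nonneg (h0 i) (Q.nonneg _ _)) (Q.summable_mul h0 hw s)

theorem integrable_mixture (Q : QuadratureKernel Γ k B δ η) (hp : IsMixture Γ p S) :
    Integrable p := by
  refine ⟨(Q.measurable_mixture hp).aestronglyMeasurable, ?_⟩
  obtain ⟨w, s, h0, hw, -, he⟩ := hp
  calc ∫⁻ y, ‖p y‖ₑ ≤ ∫⁻ y, ∑' i, ‖w i * Γ y (s i)‖ₑ := by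
        refine lintegral_mono fun y => ?_
        rw [he]
        exact enorm_tsum_le_tsum_enorm
    _ = ∑' i, ∫⁻ y, ‖w i * Γ y (s i)‖ₑ :=
        lintegral_tsum fun i => ((Q.measurable_left _).const_mul _).enorm.aemeasurable
    _ = ∑' i, ENNReal.ofReal (w i) := by
        congr 1 with i
        simp_rw [enorm_mul]
        rw [lintegral_const_mul' _ _ enorm_ne_top, Q.lintegral_enorm, mul_one,
          Real.enorm_of_nonneg (h0 i)]
    _ < ⊤ := by
        rw [← ENNReal.ofReal_tsum_of_nonneg h0 hw]
        exact ENNReal.ofReal_lt_top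

/-- Joint summability over the sources and the grid, which licenses interchanging the two sums. -/
theorem summable_prod_grid (Q : QuadratureKernel Γ k B δ η) {w : ℤ → ℝ} (h0 : ∀ i, 0 ≤ w i)
    (hw : Summable w) (s : ℤ → ℝ) :
    Summable fun q : ℤ × ℤ => w q.1 * Γ (q.2 * k) (s q.1) := by
  have hn : 0 ≤ fun q : ℤ × ℤ => w q.1 * Γ (q.2 * k) (s q.1) :=
    fun q => mul_nonneg (h0 _) (Q.nonneg _ _)
  rw [summable_prod_of_nonneg hn]
  refine ⟨fun i => (Q.summable_grid (s i)).mul_left (w i), ?_⟩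
  simp only [tsum_mul_left]
  refine Summable.of_nonneg_of_le
    (fun i => mul_nonneg (h0 i) (tsum_nonneg fun n => Q.nonneg _ _))
    (fun i => mul_le_mul_of_nonneg_left ?_ (h0 i)) (hw.mul_right ((1 + δ) / k))
  rw [le_div_iff₀' Q.k_pos]
  exact Q.grid_mass_le (s i)

/-- Sampling a mixture on the grid raises the total weight by a factor of at most `1 + δ`. -/
theorem mixture_grid_mass (Q : QuadratureKernel Γ k B δ η) (hδ : 0 ≤ δ) (hp : IsMixture Γ p S) :
    (Summable fun n : ℤ => p (n * k)) ∧ k * ∑' n : ℤ, p (n * k) ≤ (1 + δ) * S := by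
  obtain ⟨w, s, h0, hw, hS, he⟩ := hp
  have hsum := Q.summable_prod_grid h0 hw s
  simp_rw [he]
  refine ⟨hsum.prod_symm.prod, ?_⟩
  have hswap : ∑' n : ℤ, ∑' i, w i * Γ (n * k) (s i) = ∑' i, ∑' n : ℤ, w i * Γ (n * k) (s i) :=
    Summable.tsum_comm (f := fun i (n : ℤ) => w i * Γ (n * k) (s i)) hsum
  rw [hswap, ← tsum_mul_left]
  calc ∑' i, k * ∑' n : ℤ, w i * Γ (n * k) (s i) ≤ ∑' i, w i * (1 + δ) := by
        refine Summable.tsum_le_tsum (fun i => ?_) (hsum.prod.mul_left k) (hw.mul_right _)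
        rw [tsum_mul_left, mul_left_comm]
        exact mul_le_mul_of_nonneg_left (Q.grid_mass_le _) (h0 i)
    _ = (∑' i, w i) * (1 + δ) := tsum_mul_right
    _ ≤ _ := by rw [mul_comm]; gcongr

theorem isMixture_grid_step (Q : QuadratureKernel Γ k B δ η) (hδ : 0 ≤ δ)
    (hp : IsMixture Γ p S) :
    IsMixture Γ (fun x => k * ∑' n : ℤ, Γ x (n * k) * p (n * k)) ((1 + δ) * S) := by
  obtain ⟨h1, h2⟩ := Q.mixture_grid_mass hδ hp
  refine ⟨fun n => k * p (n * k), fun n => n * k,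
    fun n => mul_nonneg Q.k_pos.le (Q.mixture_nonneg hp _), h1.mul_left k, ?_, fun y => ?_⟩
  · rwa [tsum_mul_left]
  · beta_reduce
    rw [← tsum_mul_left]
    congr 1 with n
    ring

/-- The one-step quadrature error of a mixture, by linearity from that of the single transition
densities. -/
theorem lintegral_mixture_error (Q : QuadratureKernel Γ k B δ η) (hη : 0 ≤ η)
    (hp : IsMixture Γ p S) :
    ∫⁻ x, ‖(k * ∑' n : ℤ, Γ x (n * k) * p (n * k)) - ∫ y, Γ x y * p y‖ₑ ≤
      ENNReal.ofReal (S * η) := by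
  obtain ⟨w, s, h0, hw, hS, he⟩ := hp
  set D : ℝ → ℝ → ℝ := fun s x => (k * ∑' n : ℤ, Γ x (n * k) * Γ (n * k) s) - ∫ y, Γ x y * Γ y s
    with hD
  have hgrid : ∀ x s, Summable fun n : ℤ => Γ x (n * k) * Γ (n * k) s := fun x s =>
    Summable.of_nonneg_of_le (fun n => mul_nonneg (Q.nonneg _ _) (Q.nonneg _ _))
      (fun n => mul_le_mul_of_nonneg_right (Q.le_bound _ _) (Q.nonneg _ _))
      ((Q.summable_grid s).mul_left B)
  have hDm : ∀ s, Measurable (D s) := fun s =>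
    (Measurable.const_mul (measurable_tsum_of_nonneg
      (fun n => (Q.measurable_left _).mul measurable_const)
      (fun n x => mul_nonneg (Q.nonneg _ _) (Q.nonneg _ _)) fun x => hgrid x s) k).sub
      (Q.integrable_transition (Q.measurable_left s) (Q.integrable_left s)).1
  have hpt : ∀ x, (k * ∑' n : ℤ, Γ x (n * k) * p (n * k)) - ∫ y, Γ x y * p y =
      ∑' i, w i * D (s i) x := by
    intro x
    -- interchange of the two sums
    have hs1 : Summable fun q : ℤ × ℤ => w q.1 * (Γ x (q.2 * k) * Γ (q.2 * k) (s q.1)) := by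
      refine Summable.of_nonneg_of_le
        (fun q => mul_nonneg (h0 _) (mul_nonneg (Q.nonneg _ _) (Q.nonneg _ _))) (fun q => ?_)
        ((Q.summable_prod_grid h0 hw s).mul_left B)
      rw [mul_left_comm]
      exact mul_le_mul_of_nonneg_right (Q.le_bound _ _) (mul_nonneg (h0 _) (Q.nonneg _ _))
    have e1 : k * ∑' n : ℤ, Γ x (n * k) * p (n * k) =
        ∑' i, w i * (k * ∑' n : ℤ, Γ x (n * k) * Γ (n * k) (s i)) := by
      have : ∀ n : ℤ, Γ x (n * k) * p (n * k) =
          ∑' i, w i * (Γ x (n * k) * Γ (n * k) (s i)) := fun n => by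
        rw [he, ← tsum_mul_left]
        congr 1 with i
        ring
      simp_rw [this]
      have hswap : ∑' n : ℤ, ∑' i, w i * (Γ x (n * k) * Γ (n * k) (s i)) =
          ∑' i, ∑' n : ℤ, w i * (Γ x (n * k) * Γ (n * k) (s i)) :=
        Summable.tsum_comm (f := fun i (n : ℤ) => w i * (Γ x (n * k) * Γ (n * k) (s i))) hs1
      rw [hswap, ← tsum_mul_left]
      congr 1 with i
      rw [tsum_mul_left, mul_left_comm]
    have hs2 : Summable fun i => w i * (k * ∑' n : ℤ, Γ x (n * k) * Γ (n * k) (s i)) := by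
      refine (hs1.prod.mul_left k).congr fun i => ?_
      dsimp only
      rw [tsum_mul_left, mul_left_comm]
    -- interchange of the sum and the integral
    have hint : ∀ i, Integrable fun y => w i * (Γ x y * Γ y (s i)) := fun i =>
      (Q.integrable_mul (Q.integrable_left (s i)) x).const_mul _
    have hle : ∀ i, ∫ y, Γ x y * Γ y (s i) ≤ B := fun i => by
      calc ∫ y, Γ x y * Γ y (s i) ≤ ∫ y, B * Γ y (s i) :=
            integral_mono (Q.integrable_mul (Q.integrable_left (s i)) x)
              ((Q.integrable_left (s i)).const_mul B)
              fun y => mul_le_mul_of_nonneg_right (Q.le_bound _ _) (Q.nonneg _ _)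
        _ = B := by rw [integral_const_mul, Q.integral_left, mul_one]
    have hs3 : Summable fun i => w i * ∫ y, Γ x y * Γ y (s i) :=
      Summable.of_nonneg_of_le
        (fun i => mul_nonneg (h0 i)
          (integral_nonneg fun y => mul_nonneg (Q.nonneg _ _) (Q.nonneg _ _)))
        (fun i => mul_le_mul_of_nonneg_left (hle i) (h0 i)) (hw.mul_right B)
    have e2 : ∫ y, Γ x y * p y = ∑' i, w i * ∫ y, Γ x y * Γ y (s i) := by
      have : ∀ y, Γ x y * p y = ∑' i, w i * (Γ x y * Γ y (s i)) := fun y => by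
        rw [he, ← tsum_mul_left]
        congr 1 with i
        ring
      simp_rw [this]
      rw [← integral_tsum_of_summable_integral_norm hint]
      · simp_rw [integral_const_mul]
      · have hn : ∀ i y, ‖w i * (Γ x y * Γ y (s i))‖ = w i * (Γ x y * Γ y (s i)) := fun i y =>
          Real.norm_of_nonneg (mul_nonneg (h0 i) (mul_nonneg (Q.nonneg _ _) (Q.nonneg _ _)))
        simp_rw [hn, integral_const_mul]
        exact hs3
    rw [e1, e2, ← hs2.tsum_sub hs3]
    simp_rw [← mul_sub, hD]
  simp_rw [hpt]
  calc ∫⁻ x, ‖∑' i, w i * D (s i) x‖ₑ ≤ ∫⁻ x, ∑' i, ‖w i * D (s i) x‖ₑ :=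
        lintegral_mono fun x => enorm_tsum_le_tsum_enorm
    _ = ∑' i, ∫⁻ x, ‖w i * D (s i) x‖ₑ :=
        lintegral_tsum fun i => ((hDm _).const_mul _).enorm.aemeasurable
    _ ≤ ∑' i, ENNReal.ofReal (w i * η) := by
        refine ENNReal.tsum_le_tsum fun i => ?_
        simp_rw [enorm_mul]
        rw [lintegral_const_mul' _ _ enorm_ne_top, Real.enorm_of_nonneg (h0 i),
          ENNReal.ofReal_mul (h0 i)]
        gcongr
        exact Q.error_le (s i)
    _ = ENNReal.ofReal (∑' i, w i * η) :=
        (ENNReal.ofReal_tsum_of_nonneg (fun i => mul_nonneg (h0 i) hη) (hw.mul_right η)).symm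
    _ ≤ _ := by
        rw [tsum_mul_right]
        gcongr

theorem isMixture_gridDensity (Q : QuadratureKernel Γ k B δ η) (hδ : 0 ≤ δ) (n : ℕ) :
    IsMixture Γ (gridDensity Γ C k n) ((1 + δ) ^ n) := by
  induction n with
  | zero =>
    refine ⟨fun i => if i = 0 then 1 else 0, fun _ => C, fun i => by positivity, ?_, ?_,
      fun y => ?_⟩
    · exact (hasSum_ite_eq (0 : ℤ) (1 : ℝ)).summable
    · rw [tsum_ite_eq]; simp
    · simp [gridDensity]
  | succ n ih =>
    rw [pow_succ']
    exact Q.isMixture_grid_step hδ ih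

theorem summable_grid_step (Q : QuadratureKernel Γ k B δ η) (hδ : 0 ≤ δ) (n : ℕ) (x : ℝ) :
    Summable fun j : ℤ => Γ x (j * k) * gridDensity Γ C k n (j * k) := by
  have hp := Q.isMixture_gridDensity (C := C) hδ n
  exact Summable.of_nonneg_of_le (fun j => mul_nonneg (Q.nonneg _ _) (Q.mixture_nonneg hp _))
    (fun j => mul_le_mul_of_nonneg_right (Q.le_bound _ _) (Q.mixture_nonneg hp _))
    ((Q.mixture_grid_mass hδ hp).1.mul_left B)

theorem chainDensity_nonneg (Q : QuadratureKernel Γ k B δ η) (n : ℕ) (x : ℝ) :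
    0 ≤ chainDensity Γ C n x := by
  induction n generalizing x with
  | zero => exact Q.nonneg _ _
  | succ n ih => exact integral_nonneg fun y => mul_nonneg (Q.nonneg _ _) (ih y)

theorem measurable_integrable_chainDensity (Q : QuadratureKernel Γ k B δ η) (n : ℕ) :
    Measurable (chainDensity Γ C n) ∧ Integrable (chainDensity Γ C n) := by
  induction n with
  | zero => exact ⟨Q.measurable_left C, Q.integrable_left C⟩
  | succ n ih =>
    have := Q.integrable_transition ih.1 ih.2
    exact ⟨this.1, this.2.2⟩

/-- Propagation of the quadrature error: the exact transition contracts `L¹`, so the one-step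
errors add up. -/
theorem lintegral_chainDensity_sub_gridDensity (Q : QuadratureKernel Γ k B δ η) (hδ : 0 ≤ δ)
    (hη : 0 ≤ η) (n : ℕ) :
    ∫⁻ x, ‖chainDensity Γ C n x - gridDensity Γ C k n x‖ₑ ≤
      ENNReal.ofReal (n * ((1 + δ) ^ n * η)) := by
  induction n with
  | zero => simp [chainDensity, gridDensity]
  | succ n ih =>
    obtain ⟨cm, ci⟩ := Q.measurable_integrable_chainDensity (C := C) n
    have hp := Q.isMixture_gridDensity (C := C) hδ n
    have gm := Q.measurable_mixture hp
    have gi := Q.integrable_mixture hp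
    have e : ∀ x, chainDensity Γ C (n + 1) x - gridDensity Γ C k (n + 1) x =
        (∫ y, Γ x y * (chainDensity Γ C n y - gridDensity Γ C k n y)) -
        ((k * ∑' j : ℤ, Γ x (j * k) * gridDensity Γ C k n (j * k)) -
          ∫ y, Γ x y * gridDensity Γ C k n y) := by
      intro x
      simp_rw [mul_sub]
      rw [integral_sub (Q.integrable_mul ci x) (Q.integrable_mul gi x)]
      simp only [chainDensity, gridDensity]
      ring
    have tr := Q.integrable_transition (cm.sub gm) (ci.sub gi)
    simp only [Pi.sub_apply] at tr
    simp_rw [e]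
    calc _ ≤ ∫⁻ x, (‖∫ y, Γ x y * (chainDensity Γ C n y - gridDensity Γ C k n y)‖ₑ +
          ‖(k * ∑' j : ℤ, Γ x (j * k) * gridDensity Γ C k n (j * k)) -
            ∫ y, Γ x y * gridDensity Γ C k n y‖ₑ) := lintegral_mono fun x => enorm_sub_le
      _ = _ := lintegral_add_left tr.1.enorm _
      _ ≤ ENNReal.ofReal (n * ((1 + δ) ^ n * η)) + ENNReal.ofReal ((1 + δ) ^ n * η) :=
          add_le_add (tr.2.1.trans ih) (Q.lintegral_mixture_error hη hp)
      _ = ENNReal.ofReal ((n + 1) * ((1 + δ) ^ n * η)) := by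
          rw [← ENNReal.ofReal_add (by positivity) (by positivity)]
          congr 1
          ring
      _ ≤ _ := by
          refine ENNReal.ofReal_le_ofReal ?_
          push_cast
          gcongr
          · linarith
          · exact n.le_succ

end QuadratureKernel

theorem pHat_succ (f g : ℝ → ℝ) (C h k : ℝ) (n : ℕ) :
    pHat f g C h k (n + 1) = gridDensity (G f g h) C k n := by
  induction n with
  | zero => rfl
  | succ n ih =>
    ext x
    rw [pHat, ih]
    rfl

end DTQ

/-! ### The law of the Euler–Maruyama chain -/

namespace DTQ

section Chain

variable {Ω : Type*} {f g : ℝ → ℝ} {C h : ℝ} {Z : ℕ → Ω → ℝ}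

/-- The chain at step `n` is a measurable function of the first `n` noise variables. -/
theorem emChain_eq_comp (hf : Measurable f) (hg : Measurable g) (n : ℕ) :
    ∃ Φ : (Finset.range n → ℝ) → ℝ, Measurable Φ ∧
      ∀ ω, emChain f g C h Z n ω = Φ fun i => Z i ω := by
  induction n with
  | zero => exact ⟨fun _ => C, measurable_const, fun ω => rfl⟩
  | succ n ih =>
    obtain ⟨Φ, hΦ, he⟩ := ih
    set r : (Finset.range (n + 1) → ℝ) → Finset.range n → ℝ :=
      fun u i => u ⟨i, Finset.range_subset_range.2 n.le_succ i.2⟩ with hr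
    have hrm : Measurable r := measurable_pi_lambda _ fun i => measurable_pi_apply _
    have hm : Measurable fun u => Φ (r u) := hΦ.comp hrm
    refine ⟨fun u => Φ (r u) + f (Φ (r u)) * h +
      g (Φ (r u)) * √h * u ⟨n, Finset.self_mem_range_succ n⟩, ?_, fun ω => ?_⟩
    · exact (hm.add ((hf.comp hm).mul_const _)).add
        (((hg.comp hm).mul_const _).mul (measurable_pi_apply _))
    · simp only [emChain, he, hr]

variable [MeasurableSpace Ω] {P : Measure Ω}

theorem measurable_emChain (hf : Measurable f) (hg : Measurable g) (hZm : ∀ n, Measurable (Z n))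
    (n : ℕ) : Measurable (emChain f g C h Z n) := by
  obtain ⟨Φ, hΦ, he⟩ := emChain_eq_comp (C := C) (h := h) (Z := Z) hf hg n
  rw [funext he]
  exact hΦ.comp (measurable_pi_lambda _ fun i => hZm i)

theorem indepFun_emChain (hf : Measurable f) (hg : Measurable g) (hZm : ∀ n, Measurable (Z n))
    (hZi : iIndepFun Z P) (n : ℕ) : IndepFun (emChain f g C h Z n) (Z n) P := by
  obtain ⟨Φ, hΦ, he⟩ := emChain_eq_comp (C := C) (h := h) (Z := Z) hf hg n
  rw [funext he]
  have := hZi.indepFun_finset (Finset.range n) {n} (by simp) hZm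
  have hlast : Measurable fun u : ({n} : Finset ℕ) → ℝ => u ⟨n, Finset.mem_singleton_self n⟩ :=
    measurable_pi_apply _
  exact this.comp hΦ hlast

/-- The image of the standard Gaussian under one step of the chain from `y` has density
`G · y`. -/
theorem gaussianReal_map_step (hh : 0 < h) {y : ℝ} (hy : g y ≠ 0) :
    (gaussianReal 0 1).map (fun z => y + f y * h + g y * √h * z) =
      volume.withDensity fun x => ENNReal.ofReal (G f g h x y) := by
  have hv : (g y ^ 2 * h).toNNReal ≠ 0 := (Real.toNNReal_pos.2 (by positivity)).ne'
  have e : (fun z => y + f y * h + g y * √h * z) =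
      (fun z => y + f y * h + z) ∘ fun z => g y * √h * z := rfl
  rw [e, ← Measure.map_map (by fun_prop) (by fun_prop), gaussianReal_map_const_mul,
    gaussianReal_map_const_add]
  have e2 : gaussianReal (g y * √h * 0 + (y + f y * h)) (.mk ((g y * √h) ^ 2) (sq_nonneg _) * 1) =
      gaussianReal (y + f y * h) (g y ^ 2 * h).toNNReal := by
    congr 1
    · ring
    · ext
      simp [mul_pow, Real.sq_sqrt hh.le, Real.coe_toNNReal _ (by positivity : 0 ≤ g y ^ 2 * h)]
  rw [e2, gaussianReal_of_var_ne_zero _ hv]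
  congr 1
  ext x
  rw [gaussianPDF, G_eq_gaussianPDFReal f g hh.le]

/-- The Chapman–Kolmogorov equation of the chain. -/
theorem map_emChain_succ [IsProbabilityMeasure P] (hf : Measurable f) (hg : Measurable g)
    (hZm : ∀ n, Measurable (Z n)) (hZ : ∀ n, P.map (Z n) = gaussianReal 0 1)
    (hZi : iIndepFun Z P) (hh : 0 < h) (hg0 : ∀ y, g y ≠ 0)
    (hG : Measurable (Function.uncurry (G f g h))) (n : ℕ) :
    P.map (emChain f g C h Z (n + 1)) = volume.withDensity fun x =>
      ∫⁻ y, ENNReal.ofReal (G f g h x y) ∂(P.map (emChain f g C h Z n)) := by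
  have hX := measurable_emChain (C := C) (h := h) hf hg hZm n
  set μ := P.map (emChain f g C h Z n) with hμ
  have : IsProbabilityMeasure μ := Measure.isProbabilityMeasure_map hX.aemeasurable
  set Ψ : ℝ × ℝ → ℝ := fun q => q.1 + f q.1 * h + g q.1 * √h * q.2 with hΨ
  have hΨm : Measurable Ψ :=
    (measurable_fst.add ((hf.comp measurable_fst).mul_const _)).add
      (((hg.comp measurable_fst).mul_const _).mul measurable_snd)
  have hlaw : P.map (emChain f g C h Z (n + 1)) = (μ.prod (gaussianReal 0 1)).map Ψ := by
    rw [← hZ n, hμ, ← (indepFun_emChain hf hg hZm hZi n).map_prod_eq_prod_map_map hX.aemeasurable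
      (hZm n).aemeasurable, Measure.map_map hΨm (hX.prodMk (hZm n))]
    rfl
  rw [hlaw]
  ext A hA
  rw [Measure.map_apply hΨm hA, Measure.prod_apply (hΨm hA), withDensity_apply _ hA,
    lintegral_lintegral_swap (hG.ennreal_ofReal).aemeasurable]
  refine lintegral_congr fun y => ?_
  rw [← withDensity_apply _ hA, ← gaussianReal_map_step hh (hg0 y),
    Measure.map_apply (by fun_prop) hA]
  rfl

theorem map_emChain_eq_withDensity [IsProbabilityMeasure P] (hf : Measurable f)
    (hg : Measurable g) (hZm : ∀ n, Measurable (Z n))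
    (hZ : ∀ n, P.map (Z n) = gaussianReal 0 1) (hZi : iIndepFun Z P) (hh : 0 < h)
    (hg0 : ∀ y, g y ≠ 0) {k B δ η : ℝ} (Q : QuadratureKernel (G f g h) k B δ η) (n : ℕ) :
    P.map (emChain f g C h Z (n + 1)) =
      volume.withDensity fun x => ENNReal.ofReal (chainDensity (G f g h) C n x) := by
  induction n with
  | zero =>
    rw [map_emChain_succ hf hg hZm hZ hZi hh hg0 Q.measurable]
    have e : emChain f g C h Z 0 = fun _ => C := rfl
    simp [e, Measure.map_const, chainDensity]
  | succ n ih =>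
    rw [map_emChain_succ hf hg hZm hZ hZi hh hg0 Q.measurable, ih]
    congr 1
    ext x
    obtain ⟨cm, ci⟩ := Q.measurable_integrable_chainDensity (C := C) n
    rw [lintegral_withDensity_eq_lintegral_mul _ cm.ennreal_ofReal
      (Q.measurable_right x).ennreal_ofReal, chainDensity,
      ofReal_integral_eq_lintegral_ofReal (Q.integrable_mul ci x)
        (Eventually.of_forall fun y => mul_nonneg (Q.nonneg _ _) (Q.chainDensity_nonneg n y))]
    refine lintegral_congr fun y => ?_
    rw [Pi.mul_apply, mul_comm, ENNReal.ofReal_mul (Q.nonneg _ _)]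

/-- The chain has a density at every positive step, equal almost everywhere to the iterated
integral of the transition density. -/
theorem hasPDF_emChain [IsProbabilityMeasure P] (hf : Measurable f)
    (hg : Measurable g) (hZm : ∀ n, Measurable (Z n))
    (hZ : ∀ n, P.map (Z n) = gaussianReal 0 1) (hZi : iIndepFun Z P) (hh : 0 < h)
    (hg0 : ∀ y, g y ≠ 0) {k B δ η : ℝ} (Q : QuadratureKernel (G f g h) k B δ η) (n : ℕ) :
    HasPDF (emChain f g C h Z (n + 1)) P volume ∧
      pTilde P f g C h Z (n + 1) =ᵐ[volume] chainDensity (G f g h) C n := by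
  have hm := (Q.measurable_integrable_chainDensity (C := C) n).1.ennreal_ofReal
  have hmap := map_emChain_eq_withDensity (C := C) hf hg hZm hZ hZi hh hg0 Q n
  have hX := (measurable_emChain (C := C) (h := h) hf hg hZm (n + 1)).aemeasurable (μ := P)
  have hpdf : HasPDF (emChain f g C h Z (n + 1)) P volume :=
    hasPDF_of_map_eq_withDensity hX _ hm.aemeasurable hmap
  refine ⟨hpdf, ?_⟩
  have := (pdf.eq_of_map_eq_withDensity _ hm.aemeasurable).1 hmap
  filter_upwards [this] with x hx
  rw [pTilde, hx, ENNReal.toReal_ofReal (Q.chainDensity_nonneg n x)]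

end Chain

end DTQ

/-! ### The error bound -/

namespace DTQ

/-- The factor `exp (-c h^(-s))` beats every power of `h`; here the power `h⁻¹` that counts the
steps. -/
theorem exists_inv_mul_exp_neg_rpow_le {c s T : ℝ} (hc : 0 < c) (hs : 0 < s) :
    ∃ S : ℝ, ∀ h : ℝ, 0 < h → h ≤ T → h⁻¹ * Real.exp (-(c * h ^ (-s))) ≤ S := by
  obtain ⟨m, hm⟩ := exists_nat_ge s⁻¹
  have hsm : 0 ≤ s * m - 1 := by
    have := (inv_le_iff_one_le_mul₀' hs).1 hm
    linarith
  refine ⟨(m.factorial / c ^ m) * T ^ (s * m - 1), fun h hh hhT => ?_⟩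
  have hx : 0 < c * h ^ (-s) := by positivity
  have h1 : Real.exp (-(c * h ^ (-s))) ≤ m.factorial / (c * h ^ (-s)) ^ m := by
    rw [Real.exp_neg, inv_le_comm₀ (Real.exp_pos _) (by positivity), inv_div]
    exact Real.pow_div_factorial_le_exp _ hx.le m
  have h2 : (h ^ (-s)) ^ m = (h ^ (s * m))⁻¹ := by
    rw [← Real.rpow_natCast, ← Real.rpow_mul hh.le, ← Real.rpow_neg hh.le, neg_mul]
  calc h⁻¹ * Real.exp (-(c * h ^ (-s))) ≤ h⁻¹ * (m.factorial / (c * h ^ (-s)) ^ m) := by gcongr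
    _ = m.factorial / c ^ m * h ^ (s * m - 1) := by
      rw [mul_pow, h2, Real.rpow_sub hh, Real.rpow_one]
      field_simp
    _ ≤ _ := by gcongr

end DTQ

theorem theorem2 {Ω : Type*} [MeasurableSpace Ω] (P : Measure Ω) [IsProbabilityMeasure P]
    (Z : ℕ → Ω → ℝ) (hZm : ∀ n, Measurable (Z n))
    (hZ : ∀ n, P.map (Z n) = gaussianReal 0 1) (hZi : iIndepFun Z P)
    (f g : ℝ → ℝ) (d M₁ M₂ M₃ M₄ : ℝ) (hfg : DTQ.Admissible f g d M₁ M₂ M₃ M₄)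
    (C r₁ ρ r₂ T : ℝ) (hr₁ : 0 < r₁) (hρ : 1 / 2 < ρ) (hr₂ : 0 < r₂) (hT : 0 < T) :
    ∃ c : ℝ, 0 < c ∧ ∃ ε₁ ε₂ : ℝ → ℝ,
      ε₁ =o[𝓝[>] (0 : ℝ)] (fun h : ℝ => h) ∧
      ε₂ =o[𝓝[>] (0 : ℝ)] (fun k : ℝ => k) ∧
      ∀ (h k a : ℝ) (N : ℕ),
        0 < h → h < min T ((M₂ ^ 2 / (4 * M₃ * M₄ * r₂)) ^ 2) →
        0 < N → T = N * h →
        k = r₁ * h ^ ρ →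
        a = r₂ * h ^ (1 / 2 : ℝ) →
        a < min d (M₂ ^ 2 / (2 * M₃ * M₄)) →
        k ≤ 2 * Real.pi * (Real.log 2) ^ (-(1 / 2) : ℝ) * M₂ * h ^ (1 / 2 : ℝ) →
        k < 2 * Real.pi * a / Real.log 2 →
        -- the series that define `p̂` converge
        (∀ n : ℕ, 1 ≤ n → n < N → ∀ x : ℝ,
          Summable (fun j : ℤ => DTQ.G f g h x (j * k) * DTQ.pHat f g C h k n (j * k))) ∧
        -- the Euler–Maruyama chain has a density at time `T = N h`
        HasPDF (DTQ.emChain f g C h Z N) P volume ∧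
        -- the error is in `L¹`, with the stated bound
        Integrable (DTQ.err P f g C h k Z N) ∧
        ∫ x : ℝ, |DTQ.err P f g C h k Z N x| ≤
          c * h⁻¹ * Real.exp (-2 * Real.pi * r₂ * r₁⁻¹ * h ^ (1 / 2 - ρ)) *
            (1 + ε₁ h + ε₂ k) := by
  obtain ⟨F, W, hFW⟩ := hfg.exists_stripExtension
  obtain ⟨hd, h1, h2, h3, h4, -⟩ := id hfg
  obtain ⟨A, hA, hAb⟩ :=
    DTQ.StripExtension.exists_lintegral_kernel_le (M₁ := M₁) h2 h3 (r₂ ^ 2) (M₁ * T)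
  obtain ⟨S, hS⟩ := DTQ.exists_inv_mul_exp_neg_rpow_le
    (c := 2 * Real.pi * r₂ * r₁⁻¹) (s := ρ - 1 / 2) (by positivity) (by linarith)
  -- The bound holds without correction terms: they are absorbed into the constant.
  refine ⟨4 * T * A ^ 2 * Real.exp (4 * A * T * S), by positivity, fun _ => 0, fun _ => 0,
    isLittleO_zero _ _, isLittleO_zero _ _, ?_⟩
  intro h k a N hh hhlt hN hTN hk ha had _ hka
  obtain ⟨hhT, hhM⟩ := lt_min_iff.1 hhlt
  have hk0 : 0 < k := by rw [hk]; positivity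
  have ha0 : 0 < a := by rw [ha]; positivity
  have ha2 : a ^ 2 = r₂ ^ 2 * h := by
    rw [ha, ← Real.sqrt_eq_rpow, mul_pow, Real.sq_sqrt hh.le]
  have haM : a ≤ M₂ ^ 2 / (4 * M₃ * M₄) := by
    rw [← sq_le_sq₀ ha0.le (by positivity), ha2]
    calc r₂ ^ 2 * h ≤ r₂ ^ 2 * (M₂ ^ 2 / (4 * M₃ * M₄ * r₂)) ^ 2 := by gcongr
      _ = _ := by field_simp
  have H := hFW a ha0.le (had.trans_le (min_le_left _ _)) haM
  have Q := H.quadratureKernel hh ha0 hk0 hA.le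
    (hAb f g F W a h H hh ha2.le (by gcongr))
  -- the exponent of the trapezoidal rule
  set u := 2 * Real.pi * a / k with hu
  have hu2 : u = 2 * Real.pi * r₂ * r₁⁻¹ * h ^ (-(ρ - 1 / 2)) := by
    rw [hu, ha, hk, neg_sub, Real.rpow_sub hh]
    have := (Real.rpow_pos_of_pos hh ρ).ne'
    field_simp
  have hexp2 : 2 ≤ Real.exp u := by
    have hlog : Real.log 2 < u := by
      have h0 : 0 < Real.log 2 := Real.log_pos one_lt_two
      rw [hu, lt_div_iff₀ hk0]
      rw [lt_div_iff₀ h0] at hka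
      linarith
    exact ((Real.log_lt_iff_lt_exp two_pos).1 hlog).le
  have hinv : (Real.exp u - 1)⁻¹ ≤ 2 * Real.exp (-u) := by
    rw [Real.exp_neg, inv_le_comm₀ (by linarith) (by positivity), mul_inv, inv_inv]
    linarith
  have hq0 : 0 < Real.exp u - 1 := by linarith
  have hδ0 : 0 ≤ 2 * A / (Real.exp u - 1) := by positivity
  have hη0 : 0 ≤ 2 * A ^ 2 / (Real.exp u - 1) := by positivity
  have hδ : 2 * A / (Real.exp u - 1) ≤ 4 * A * Real.exp (-u) := by
    rw [div_eq_mul_inv]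
    calc _ ≤ 2 * A * (2 * Real.exp (-u)) := by gcongr
      _ = _ := by ring
  have hη : 2 * A ^ 2 / (Real.exp u - 1) ≤ 4 * A ^ 2 * Real.exp (-u) := by
    rw [div_eq_mul_inv]
    calc _ ≤ 2 * A ^ 2 * (2 * Real.exp (-u)) := by gcongr
      _ = _ := by ring
  obtain ⟨n, rfl⟩ : ∃ n, N = n + 1 := ⟨N - 1, by omega⟩
  have hnT : (n : ℝ) ≤ T * h⁻¹ := by
    rw [hTN, mul_inv_cancel_right₀ hh.ne']
    push_cast
    linarith
  -- the accumulated growth of the grid mass stays bounded as `h → 0`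
  have hgrow : (1 + 2 * A / (Real.exp u - 1)) ^ n ≤ Real.exp (4 * A * T * S) := by
    have hSh := hS h hh hhT.le
    rw [← hu2] at hSh
    calc (1 + 2 * A / (Real.exp u - 1)) ^ n
        ≤ Real.exp (2 * A / (Real.exp u - 1)) ^ n := by
          gcongr
          rw [add_comm]
          exact Real.add_one_le_exp _
      _ = Real.exp (n * (2 * A / (Real.exp u - 1))) := (Real.exp_nat_mul _ _).symm
      _ ≤ Real.exp (4 * A * T * S) := by
          refine Real.exp_le_exp.2 ?_
          calc n * (2 * A / (Real.exp u - 1)) ≤ T * h⁻¹ * (4 * A * Real.exp (-u)) := by gcongr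
            _ = 4 * A * T * (h⁻¹ * Real.exp (-u)) := by ring
            _ ≤ _ := by gcongr
  obtain ⟨hpdf, hae⟩ := DTQ.hasPDF_emChain (P := P) (C := C) H.continuous_f.measurable
    hfg.continuous_g.measurable hZm hZ hZi hh H.g_ne_zero Q n
  obtain ⟨-, ci⟩ := Q.measurable_integrable_chainDensity (C := C) n
  have gi := Q.integrable_mixture (Q.isMixture_gridDensity (C := C) hδ0 n)
  have herr : DTQ.err P f g C h k Z (n + 1) =ᵐ[volume] fun x =>
      DTQ.chainDensity (DTQ.G f g h) C n x - DTQ.gridDensity (DTQ.G f g h) C k n x := by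
    filter_upwards [hae] with x hx
    rw [DTQ.err, hx, DTQ.pHat_succ]
  have hint : Integrable fun x =>
      DTQ.chainDensity (DTQ.G f g h) C n x - DTQ.gridDensity (DTQ.G f g h) C k n x := ci.sub gi
  refine ⟨fun m hm _ x => ?_, hpdf, hint.congr herr.symm, ?_⟩
  · obtain ⟨m, rfl⟩ : ∃ l, m = l + 1 := ⟨m - 1, by omega⟩
    rw [DTQ.pHat_succ]
    exact Q.summable_grid_step hδ0 m x
  · have habs : (fun x => |DTQ.err P f g C h k Z (n + 1) x|) =ᵐ[volume] fun x =>
        ‖DTQ.chainDensity (DTQ.G f g h) C n x - DTQ.gridDensity (DTQ.G f g h) C k n x‖ := by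
      filter_upwards [herr] with x hx
      rw [hx, Real.norm_eq_abs]
    rw [integral_congr_ae habs, integral_norm_eq_lintegral_enorm hint.aestronglyMeasurable]
    refine (ENNReal.toReal_le_of_le_ofReal (by positivity)
      (Q.lintegral_chainDensity_sub_gridDensity hδ0 hη0 n)).trans ?_
    have hneg : -2 * Real.pi * r₂ * r₁⁻¹ * h ^ (1 / 2 - ρ) = -u := by
      rw [hu2, neg_sub]
      ring
    rw [hneg, add_zero, add_zero, mul_one]
    calc n * ((1 + 2 * A / (Real.exp u - 1)) ^ n * (2 * A ^ 2 / (Real.exp u - 1)))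
        ≤ T * h⁻¹ * (Real.exp (4 * A * T * S) * (4 * A ^ 2 * Real.exp (-u))) := by gcongr
      _ = _ := by ring
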